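/- Let $q$ be a prime power and $\mathbb F_q$ the field with $q$ elements. Every function $f:\mathbb F_q^n\to\mathbb F_q$ has a unique expression as a polynomial with all individual degrees at most $q-1$; $\deg f$ is the total degree of that polynomial. For $0<\delta\le 1$, the function $f$ is called $\delta$-far from degree $d$ if $\Pr_{x\in\mathbb F_q^n}[f(x)\ne g(x)]\ge\delta$ (with $x$ uniform) for every $g:\mathbb F_q^n\to\mathbb F_q$ with $\deg g\le d$. In the $t$-online-erasure model, a randomized, possibly adaptive algorithm queries entries of the truth table of $f$, which are all unerased at the start. After each query an adversary, who knows $f$, the description of the algorithm and the queries made so far, but not the future coin tosses, erases at most $t$ entries. A query to an entry that has not been erased is answered by $f(x)$, and a query to an erased entry is answered by $\perp$. The query complexity is the maximal number of queries, over all coin tosses and all answers. **Theorem.** For every integer $d\ge 0$ there is a constant $C$, depending only on $d$, such that the following holds for every prime power $q$, all integers $n\ge 0$ and $t\ge 1$, and every $\delta\in(0,1]$ with $$t\le\frac{\delta}{100}\,q^{\frac{n}{100(d+q)}-1}.$$ There is a randomized algorithm with query complexity at most $$\frac{C\,q^{C}}{\delta}\,\bigl(\max\{C,\log(t/\delta)\}\bigr)^{3d+3q}$$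 such that, for every $f:\mathbb F_q^n\to\mathbb F_q$ and against every adversary in the $t$-online-erasure model, * (completeness) if $\deg f\le d$, then the algorithm accepts with probability $1$; * (soundness) if $f$ is $\delta$-far from degree $d$, then the algorithm rejects with probability at least $2/3$. In particular, as soon as $\log(t/\delta)\ge C$, the query complexity is at most $\frac{C\,q^{C}}{\delta}\log^{3d+3q}(t/\delta)$, that is, $\frac{q^{O(1)}}{\delta}\,O\bigl(\log^{3d+3q}(t/\delta)\bigr)$ with constants that do not depend on $q$, $n$, $t$, $\delta$. -/

import Mathlib

open scoped ENNReal

/-- A deterministic adaptive query algorithm with inputs `X → Y`: a decision tree which either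
stops and outputs accept (`true`) or reject (`false`), or queries a point `x` and continues
according to the answer. The answer `none` is the erasure symbol `⊥`. -/
inductive QueryTree (X : Type*) (Y : Type*) where
  | output (accept : Bool) : QueryTree X Y
  | query (x : X) (next : Option Y → QueryTree X Y) : QueryTree X Y

/-- The algorithm makes at most `m` queries, whatever answers it receives. -/
def QueryTree.QueriesAtMost {X Y : Type*} : QueryTree X Y → ℕ → Prop
  | .output _, _ => True
  | .query _ _, 0 => False
  | .query _ next, m + 1 => ∀ a : Option Y, (next a).QueriesAtMost m

/-- A strategy of a `t`-online-erasure adversary. After each query, it looks at the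
(chronological) list of all queries made so far, the last one included, and erases at most `t`
entries. It may depend on the input function and on the description of the algorithm, since
it is universally quantified after both, but it does not see the future coins. (The answers given
so far are determined by the input function, the strategy and the list of queries.) -/
structure ErasureAdversary (X : Type*) (t : ℕ) where
  erase : List X → Finset X
  card_le : ∀ history, (erase history).card ≤ t

/-- The output of the remaining computation on input `f` against the adversary `adv`, where
`history` is the list of queries made so far and `erased` is the set of entries erased so far. -/
def QueryTree.runFrom {X Y : Type*} [DecidableEq X] {t : ℕ} (f : X → Y)
    (adv : ErasureAdversary X t) : QueryTree X Y → List X → Finset X → Bool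
  | .output b, _, _ => b
  | .query x next, history, erased =>
      (next (if x ∈ erased then none else some (f x))).runFrom f adv (history ++ [x])
        (erased ∪ adv.erase (history ++ [x]))

/-- The output on input `f` against `adv`; at the start nothing is queried or erased. -/
def QueryTree.run {X Y : Type*} [DecidableEq X] {t : ℕ} (f : X → Y)
    (adv : ErasureAdversary X t) (T : QueryTree X Y) : Bool :=
  T.runFrom f adv [] ∅

/-- A randomized query algorithm: a probability distribution on deterministic ones. -/
abbrev RandomizedAlgorithm (X : Type*) (Y : Type*) := PMF (QueryTree X Y)

/-- Worst-case query complexity at most `m`: for all coins and all answers. -/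
def RandomizedAlgorithm.QueriesAtMost {X Y : Type*} (A : RandomizedAlgorithm X Y) (m : ℕ) :
    Prop :=
  ∀ T ∈ A.support, T.QueriesAtMost m

/-- The distribution of the output on input `f` against `adv`, over the coins of `A`. -/
noncomputable def RandomizedAlgorithm.outputDist {X Y : Type*} [DecidableEq X] {t : ℕ}
    (A : RandomizedAlgorithm X Y) (f : X → Y) (adv : ErasureAdversary X t) : PMF Bool :=
  A.map (fun T => T.run f adv)

/-- The functions `F ^ n → F` of degree at most `d`: the reduced polynomial expression (all
individual degrees at most `q - 1`) of the function has total degree at most `d`. -/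
def reedMuller (F : Type*) [Field F] [Fintype F] (n d : ℕ) : Set ((Fin n → F) → F) :=
  {f | ∃ P ∈ MvPolynomial.restrictDegree (Fin n) F (Fintype.card F - 1),
    P.totalDegree ≤ d ∧ ∀ x, MvPolynomial.eval x P = f x}

/-- Fractional Hamming distance: the probability that `f x ≠ g x` for uniformly random `x`. -/
noncomputable def fracDist {X Y : Type*} [Fintype X] [DecidableEq Y] (f g : X → Y) : ℝ :=
  (hammingDist f g : ℝ) / (Fintype.card X : ℝ)

/-- `f` is `δ`-far from degree `d`: its distance to every function of degree at most `d` is at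
least `δ`. -/
def IsFarFromDegree {F : Type*} [Field F] [Fintype F] [DecidableEq F] {n : ℕ}
    (δ : ℝ) (d : ℕ) (f : (Fin n → F) → F) : Prop :=
  ∀ g ∈ reedMuller F n d, δ ≤ fracDist f g

/-- `A` is a `t`-online-erasure-resilient tester for degree at most `d` on functions
`F ^ n → F`, with distance parameter `δ`, perfect completeness and soundness `2 / 3`. -/
structure IsErasureResilientDegreeTester {F : Type*} [Field F] [Fintype F] [DecidableEq F]
    {n : ℕ} (t d : ℕ) (δ : ℝ) (A : RandomizedAlgorithm (Fin n → F) F) : Prop where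
  completeness : ∀ f ∈ reedMuller F n d, ∀ adv : ErasureAdversary (Fin n → F) t,
    A.outputDist f adv true = 1
  soundness : ∀ f : (Fin n → F) → F, IsFarFromDegree δ d f →
    ∀ adv : ErasureAdversary (Fin n → F) t, (2 / 3 : ℝ≥0∞) ≤ A.outputDist f adv false

/-! ### Reduced polynomials and restriction to affine subspaces -/

section ReedMuller

open MvPolynomial

/-! The tester confines its queries to a random surface that is small enough for the possible
restrictions of low-degree functions to be few, yet too large for the adversary to erase.

Call a parametrized `(d + 1)`-dimensional affine subspace violated if `f` restricted to it has
degree above `d`. Self-correction shows that a `δ`-far `f` violates a random one with probability `ρ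
≥ δ / (3 K ^ 2)`, where `K = q ^ (d + 1)` (`rejProb_ge_of_isFarFromDegree`). Querying such a
subspace directly would let the adversary erase the rest of it. Instead, a random affine map from `F
^ r` to the parameters `(b, M)` of subspaces gives `q ^ r` pairwise independent subspaces, which
sweep out the surface. By Chebyshev, usually at least a fraction `ρ / 2` of them is violated
(`prob_not_isGoodSurface_le`), so every `g` of degree at most `d` differs from `f` on a fraction at
least `ρ / (2 K)` of the surface. Erasing `t * m` points spoils only a fraction `t * m / q ^ r`,
even if the surface is known to the adversary.

The test queries `m` random points of the surface and accepts if some `g` of degree at most `d` fits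
the unerased answers. Completeness is immediate. For soundness, a fixed `g` survives with
probability at most `(1 - ε) ^ m`, `ε = δ / (12 K ^ 3)` (`prob_survives_le`). The surface has degree
2, so restrictions to it have degree at most `2 d` in `d + 1 + r` variables, and there are at most
`q ^ N` of them, `N` being the number of monomials (`ncard_surface_restrictions_le`). A union bound
needs `m` of order `N q / ε`. Since `r` is logarithmic in `t / δ` and `N` is polynomial in `r`, so
is the query count. -/

theorem totalDegree_bind₁_le {F : Type*} [Field F] {σ τ : Type*} [Fintype σ] (P : MvPolynomial σ F)
    (Q : σ → MvPolynomial τ F) {D e : ℕ} (hP : P.totalDegree ≤ D)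
    (hQ : ∀ i, (Q i).totalDegree ≤ e) : (bind₁ Q P).totalDegree ≤ D * e := by
  classical
  rw [bind₁, aeval_def, eval₂_eq']
  refine totalDegree_finsetSum_le fun m hm => ?_
  have hm' : ∑ i, m i ≤ D := by
    have := le_totalDegree hm
    rw [Finsupp.sum_fintype _ _ (fun _ => rfl)] at this
    exact this.trans hP
  calc _ ≤ (algebraMap F (MvPolynomial τ F) (coeff m P)).totalDegree
        + (∏ i, Q i ^ m i).totalDegree := totalDegree_mul _ _
    _ ≤ 0 + ∑ i, (Q i ^ m i).totalDegree := by
        refine add_le_add ?_ (totalDegree_finsetProd _ _)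
        rw [algebraMap_eq, totalDegree_C]
    _ ≤ ∑ i, m i * e := by
        rw [zero_add]
        refine Finset.sum_le_sum fun i _ => (totalDegree_pow _ _).trans ?_
        exact Nat.mul_le_mul_left _ (hQ i)
    _ = (∑ i, m i) * e := (Finset.sum_mul _ _ _).symm
    _ ≤ D * e := Nat.mul_le_mul_right _ hm'

theorem totalDegree_linear_le {F : Type*} [Field F] {k : ℕ} (b : F) (c : Fin k → F) :
    (C b + ∑ i, X i * C (c i) : MvPolynomial (Fin k) F).totalDegree ≤ 1 := by
  refine (totalDegree_add _ _).trans (max_le (by simp) ?_)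
  refine totalDegree_finsetSum_le fun i _ => (totalDegree_mul _ _).trans ?_
  simp

theorem eval_bind₁ {F : Type*} [Field F] {σ τ : Type*} (Q : σ → MvPolynomial τ F)
    (P : MvPolynomial σ F) (y : τ → F) : eval y (bind₁ Q P) = eval (fun i => eval y (Q i)) P := by
  rw [hom_bind₁, show (eval y).comp C = RingHom.id F by ext; simp]
  rfl

/-- The affine map `F ^ k → W` with the given value at `0` and the given linear part. -/
def affineMapOf {F : Type*} [Field F] {k : ℕ} {W : Type*} [AddCommGroup W] [Module F W] (b : W)
    (M : Fin k → W) (y : Fin k → F) : W :=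
  b + ∑ i, y i • M i

variable {F : Type*} [Field F] [Fintype F]

theorem eq_zero_of_mem_restrictDegree_of_eval_eq_zero {n : ℕ} {P : MvPolynomial (Fin n) F}
    (hP : P ∈ restrictDegree (Fin n) F (Fintype.card F - 1)) (h : ∀ x, eval x P = 0) : P = 0 := by
  have hq : 1 < Fintype.card F := Fintype.one_lt_card
  refine eq_zero_of_eval_zero_at_prod_finset P (fun _ => Finset.univ) (fun i => ?_) fun x _ => h x
  rw [Finset.card_univ]
  have : P.degreeOf i ≤ Fintype.card F - 1 :=
    degreeOf_le_iff.2 fun m hm => (mem_restrictDegree _ _ _).1 hP m hm i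
  omega

/-- By `x ^ q = x`, an exponent above `q - 1` may be lowered by `q - 1`. It stays at least `1`, so
`x = 0` is no exception. -/
theorem exists_reduced_exponent (e : ℕ) :
    ∃ e' ≤ e, e' ≤ Fintype.card F - 1 ∧ ∀ x : F, x ^ e' = x ^ e := by
  have hq : 1 < Fintype.card F := Fintype.one_lt_card
  induction e using Nat.strong_induction_on with
  | _ e ih =>
    by_cases he : e ≤ Fintype.card F - 1
    · exact ⟨e, le_rfl, he, fun _ => rfl⟩
    · obtain ⟨e', h1, h2, h3⟩ := ih (e - (Fintype.card F - 1)) (by omega)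
      refine ⟨e', by omega, h2, fun x => ?_⟩
      rw [h3]
      obtain ⟨j, rfl⟩ : ∃ j, e = Fintype.card F + j := ⟨e - Fintype.card F, by omega⟩
      rw [show Fintype.card F + j - (Fintype.card F - 1) = j + 1 by omega, pow_add,
        pow_add x (Fintype.card F), FiniteField.pow_card, pow_one, mul_comm]

theorem reedMuller_zero_mem {n d : ℕ} : (fun _ => 0) ∈ reedMuller F n d :=
  ⟨0, Submodule.zero_mem _, by simp, by simp⟩

theorem reedMuller_add_mem {n d : ℕ} {f g : (Fin n → F) → F} (hf : f ∈ reedMuller F n d)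
    (hg : g ∈ reedMuller F n d) : (fun x => f x + g x) ∈ reedMuller F n d := by
  obtain ⟨P, hP, hPd, hPf⟩ := hf
  obtain ⟨Q, hQ, hQd, hQf⟩ := hg
  exact ⟨P + Q, Submodule.add_mem _ hP hQ, (totalDegree_add _ _).trans (max_le hPd hQd),
    fun x => by rw [map_add, hPf, hQf]⟩

theorem reedMuller_neg_mem {n d : ℕ} {f : (Fin n → F) → F} (hf : f ∈ reedMuller F n d) :
    (fun x => -f x) ∈ reedMuller F n d := by
  obtain ⟨P, hP, hPd, hPf⟩ := hf
  exact ⟨-P, Submodule.neg_mem _ hP, by rwa [totalDegree_neg], fun x => by rw [map_neg, hPf]⟩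

theorem reedMuller_sum_mem {n d : ℕ} {ι : Type*} (s : Finset ι) {f : ι → (Fin n → F) → F}
    (hf : ∀ i ∈ s, f i ∈ reedMuller F n d) : (fun x => ∑ i ∈ s, f i x) ∈ reedMuller F n d := by
  classical
  induction s using Finset.induction_on with
  | empty => simpa using reedMuller_zero_mem
  | insert a s ha ih =>
    simp only [Finset.sum_insert ha]
    exact reedMuller_add_mem (hf a (Finset.mem_insert_self _ _))
      (ih fun i hi => hf i (Finset.mem_insert_of_mem hi))

/-- Every polynomial of total degree at most `d`, reduced or not, defines a function of degree at
most `d`. -/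
theorem eval_mem_reedMuller {n d : ℕ} (P : MvPolynomial (Fin n) F) (hP : P.totalDegree ≤ d) :
    (fun x => eval x P) ∈ reedMuller F n d := by
  classical
  simp only [eval_eq']
  refine reedMuller_sum_mem _ fun m hm => ?_
  have hm' : ∑ i, m i ≤ d := by
    have := le_totalDegree hm
    rw [Finsupp.sum_fintype _ _ (fun _ => rfl)] at this
    exact this.trans hP
  choose r hr1 hr2 hr3 using exists_reduced_exponent (F := F)
  let m' : Fin n →₀ ℕ := Finsupp.equivFunOnFinite.symm fun i => r (m i)
  refine ⟨monomial m' (coeff m P), ?_, ?_, fun x => ?_⟩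
  · rw [mem_restrictDegree]
    intro s hs i
    have := support_monomial_subset hs
    rw [Finset.mem_singleton] at this
    subst this
    exact hr2 _
  · refine (totalDegree_monomial_le _ _).trans ?_
    rw [Finsupp.sum_fintype _ _ (fun _ => rfl)]
    exact (Finset.sum_le_sum fun i _ => hr1 (m i)).trans hm'
  · rw [eval_monomial, Finsupp.prod_fintype _ _ (fun _ => pow_zero _)]
    simp only [m', Finsupp.coe_equivFunOnFinite_symm, hr3]

theorem reedMuller_comp_mem {n k d : ℕ} {f : (Fin n → F) → F} (hf : f ∈ reedMuller F n d)
    (Q : Fin n → MvPolynomial (Fin k) F) (hQ : ∀ i, (Q i).totalDegree ≤ 1) :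
    (fun y => f fun i => eval y (Q i)) ∈ reedMuller F k d := by
  obtain ⟨P, -, hPd, hPf⟩ := hf
  have : (fun y => f fun i => eval y (Q i)) = fun y => eval y (bind₁ Q P) := by
    funext y
    rw [← hPf, eval_bind₁]
  rw [this]
  exact eval_mem_reedMuller _ (by simpa using totalDegree_bind₁_le P Q hPd hQ)

theorem reedMuller_comp_affine_mem {n k d : ℕ} {f : (Fin n → F) → F} (hf : f ∈ reedMuller F n d)
    (b : Fin n → F) (M : Fin k → Fin n → F) :
    (fun y => f (affineMapOf b M y)) ∈ reedMuller F k d := by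
  convert reedMuller_comp_mem hf (fun i => C (b i) + ∑ j, X j * C (M j i))
    (fun i => totalDegree_linear_le _ _) using 3 with y
  funext i
  simp [affineMapOf, Finset.sum_apply]

/-- Since `d < (q - 1) (d + 1)`, each monomial has a variable with exponent below `q - 1`, and
summing over that variable gives `0`. This is the parity check behind interpolation; dimension `d +
1` suffices for every `q`. -/
theorem sum_eq_zero_of_mem_reedMuller {d : ℕ} {f : (Fin (d + 1) → F) → F}
    (hf : f ∈ reedMuller F (d + 1) d) : ∑ y, f y = 0 := by
  classical
  obtain ⟨P, -, hPd, hPf⟩ := hf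
  simp only [← hPf]
  apply sum_eval_eq_zero
  have hq : 1 < Fintype.card F := Fintype.one_lt_card
  rw [Fintype.card_fin]
  have : 1 * (d + 1) ≤ (Fintype.card F - 1) * (d + 1) := Nat.mul_le_mul_right _ (by omega)
  omega

theorem exists_reduced_polynomial {n : ℕ} (f : (Fin n → F) → F) :
    ∃ P ∈ restrictDegree (Fin n) F (Fintype.card F - 1), ∀ x, eval x P = f x := by
  have h : f ∈ (restrictDegree (Fin n) F (Fintype.card F - 1)).map (evalₗ F (Fin n)) := by
    rw [map_restrict_dom_evalₗ]; trivial
  obtain ⟨P, hP, rfl⟩ := h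
  exact ⟨P, hP, fun _ => rfl⟩

theorem coeff_eq_zero_of_eval_mem_reedMuller {n d : ℕ} {P : MvPolynomial (Fin n) F}
    (hP : P ∈ restrictDegree (Fin n) F (Fintype.card F - 1))
    (h : (fun x => eval x P) ∈ reedMuller F n d) {m : Fin n →₀ ℕ} (hm : d < m.degree) :
    coeff m P = 0 := by
  obtain ⟨Q, hQ, hQd, hQe⟩ := h
  have : P = Q := by
    rw [← sub_eq_zero]
    refine eq_zero_of_mem_restrictDegree_of_eval_eq_zero (Submodule.sub_mem _ hP hQ) fun v => ?_
    rw [map_sub, hQe, sub_self]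
  subst this
  exact coeff_eq_zero_of_totalDegree_lt (lt_of_le_of_lt hQd hm)

/-- Fixing the variables outside `S` to `β` is a substitution that factors through `F ^ (d + 1)`
when `S` has at most `d + 1` elements. -/
theorem fix_variables_mem_reedMuller {n d : ℕ} {g : (Fin n → F) → F}
    (h : ∀ (b : Fin n → F) (M : Fin (d + 1) → Fin n → F),
      (fun y => g (affineMapOf b M y)) ∈ reedMuller F (d + 1) d)
    (S : Finset (Fin n)) (hS : S.card ≤ d + 1) (β : Fin n → F) :
    (fun x => g fun i => if i ∈ S then x i else β i) ∈ reedMuller F n d := by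
  classical
  obtain ⟨e, he⟩ : ∃ e : Fin n → Fin (d + 1), Set.InjOn e S := by
    have : Fintype.card S ≤ Fintype.card (Fin (d + 1)) := by simpa using hS
    obtain ⟨φ⟩ := Function.Embedding.nonempty_of_card_le this
    refine ⟨fun i => if hi : i ∈ S then φ ⟨i, hi⟩ else 0, fun i hi j hj hij => ?_⟩
    have hi' : i ∈ S := hi
    have hj' : j ∈ S := hj
    simp only [hi', hj', dif_pos] at hij
    simpa using φ.injective hij
  -- `A` projects to the coordinates in `S`, relabelled by `e`; `M` puts them back, and `b` supplies
  -- `β` elsewhere.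
  let b : Fin n → F := fun i => if i ∈ S then 0 else β i
  let M : Fin (d + 1) → Fin n → F := fun l i => if i ∈ S ∧ e i = l then 1 else 0
  let A : Fin n → Fin (d + 1) → F := fun i l => if i ∈ S ∧ e i = l then 1 else 0
  convert reedMuller_comp_affine_mem (h b M) 0 A using 3 with x
  funext i
  simp only [affineMapOf, Pi.add_apply, Finset.sum_apply, Pi.smul_apply, b, M, A, smul_eq_mul,
    Pi.zero_apply, zero_add, mul_ite, mul_one, mul_zero]
  by_cases hi : i ∈ S
  · simp only [hi, if_true, true_and, zero_add, Finset.sum_ite_eq, Finset.mem_univ]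
    rw [Finset.sum_eq_single i]
    · simp [hi]
    · intro j _ hj
      rw [if_neg]
      rintro ⟨h1, h2⟩
      exact hj (he h1 hi h2)
    · simp
  · simp [hi]

theorem exists_small_subset_of_lt_degree {n d : ℕ} (m : Fin n →₀ ℕ) (hm : d < m.degree) :
    ∃ S : Finset (Fin n), S.card ≤ d + 1 ∧ d < ∑ i ∈ S, m i := by
  classical
  by_cases h : m.support.card ≤ d + 1
  · exact ⟨m.support, h, hm⟩
  · obtain ⟨S, hS, hc⟩ := Finset.exists_subset_card_eq (s := m.support) (n := d + 1) (by omega)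
    refine ⟨S, hc.le, ?_⟩
    calc d < S.card := by omega
      _ = ∑ i ∈ S, 1 := by simp
      _ ≤ ∑ i ∈ S, m i := Finset.sum_le_sum fun i hi =>
          Nat.one_le_iff_ne_zero.2 (Finsupp.mem_support_iff.1 (hS hi))

/-- Being of degree at most `d` is a property of the restrictions to `(d + 1)`-dimensional affine
subspaces. -/
theorem mem_reedMuller_of_affine_restrictions {n d : ℕ} {g : (Fin n → F) → F}
    (h : ∀ (b : Fin n → F) (M : Fin (d + 1) → Fin n → F),
      (fun y => g (affineMapOf b M y)) ∈ reedMuller F (d + 1) d) :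
    g ∈ reedMuller F n d := by
  classical
  obtain ⟨P, hP, hPg⟩ := exists_reduced_polynomial g
  have hPm := (mem_restrictDegree _ _ _).1 hP
  refine ⟨P, hP, ?_, hPg⟩
  refine Finset.sup_le fun m₀ hm₀ => ?_
  by_contra! hlt
  obtain ⟨S, hS, hSd⟩ := exists_small_subset_of_lt_degree m₀ hlt
  -- `R β` is `P` with the variables outside `S` fixed to `β`. Its coefficient at the `S`-part of
  -- `m₀` is `Q` evaluated at `β`. That part has degree above `d`, so the coefficient vanishes for
  -- all `β`; hence `Q = 0`, although the coefficient of `m₀` in `P` is one of its coefficients.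
  let R (β : Fin n → F) : MvPolynomial (Fin n) F := ∑ m ∈ P.support,
    monomial (m.filter (· ∈ S)) (coeff m P * ∏ i, if i ∈ S then 1 else β i ^ m i)
  let Q : MvPolynomial (Fin n) F := ∑ m ∈ P.support with
    m.filter (· ∈ S) = m₀.filter (· ∈ S), monomial (m.filter (· ∉ S)) (coeff m P)
  have hmono : ∀ m ∈ P.support, ∀ (p : Fin n → Prop) [DecidablePred p] (c : F),
      monomial (m.filter p) c ∈ restrictDegree (Fin n) F (Fintype.card F - 1) := by
    intro m hm p _ c
    rw [mem_restrictDegree]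
    intro s hs i
    have := support_monomial_subset hs
    rw [Finset.mem_singleton] at this
    subst this
    rw [Finsupp.filter_apply]
    split_ifs
    · exact hPm m hm i
    · exact Nat.zero_le _
  have hR (β) : R β ∈ restrictDegree (Fin n) F (Fintype.card F - 1) :=
    Submodule.sum_mem _ fun m hm => hmono m hm _ _
  have hQ : Q ∈ restrictDegree (Fin n) F (Fintype.card F - 1) :=
    Submodule.sum_mem _ fun m hm => hmono m (Finset.mem_filter.1 hm).1 _ _
  have hReval (β x : Fin n → F) : eval x (R β) = g fun i => if i ∈ S then x i else β i := by
    rw [← hPg, eval_eq' _ P, map_sum]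
    refine Finset.sum_congr rfl fun m _ => ?_
    rw [eval_monomial, Finsupp.prod_fintype _ _ (fun _ => pow_zero _), mul_assoc,
      ← Finset.prod_mul_distrib]
    congr 1
    refine Finset.prod_congr rfl fun i _ => ?_
    by_cases hi : i ∈ S <;> simp [hi]
  have hcoeff (β : Fin n → F) : coeff (m₀.filter (· ∈ S)) (R β) = eval β Q := by
    rw [coeff_sum, map_sum, Finset.sum_filter]
    refine Finset.sum_congr rfl fun m _ => ?_
    rw [coeff_monomial]
    split_ifs with hm
    · rw [eval_monomial, Finsupp.prod_fintype _ _ (fun _ => pow_zero _)]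
      congr 1
      refine Finset.prod_congr rfl fun i _ => ?_
      by_cases hi : i ∈ S <;> simp [hi]
    · rfl
  have hdeg : d < (m₀.filter (· ∈ S)).degree := by
    rw [Finsupp.degree_eq_sum]
    simpa [Finsupp.filter_apply, Finset.sum_ite_mem] using hSd
  have hQ0 : Q = 0 := by
    refine eq_zero_of_mem_restrictDegree_of_eval_eq_zero hQ fun β => ?_
    rw [← hcoeff]
    refine coeff_eq_zero_of_eval_mem_reedMuller (hR β) ?_ hdeg
    simp only [hReval]
    exact fix_variables_mem_reedMuller h S hS β
  have hc : coeff (m₀.filter (· ∉ S)) Q = coeff m₀ P := by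
    rw [coeff_sum, Finset.sum_eq_single m₀]
    · simp
    · intro m hm hne
      rw [coeff_monomial, if_neg]
      intro heq
      apply hne
      rw [← Finsupp.filter_add_filter_not m (· ∈ S), (Finset.mem_filter.1 hm).2, heq,
        Finsupp.filter_add_filter_not]
    · intro hm
      exact absurd (by simpa using mem_support_iff.1 hm₀) hm
  rw [hQ0, coeff_zero] at hc
  exact (mem_support_iff.1 hm₀) hc.symm

end ReedMuller

/-! ### Probability under the uniform distribution -/

section UniformProbability

open Classical in
/-- The probability of an event under the uniform distribution on a finite type. -/
noncomputable def prob {α : Type*} [Fintype α] (p : α → Prop) : ℝ :=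
  ((Finset.univ.filter p).card : ℝ) / Fintype.card α

variable {α β : Type*} [Fintype α] [Fintype β]

theorem prob_eq_card_div (p : α → Prop) [DecidablePred p] :
    prob p = ((Finset.univ.filter p).card : ℝ) / Fintype.card α := by
  unfold prob; congr

theorem prob_nonneg (p : α → Prop) : 0 ≤ prob p := by
  unfold prob; positivity

theorem prob_mono {p r : α → Prop} (h : ∀ a, p a → r a) : prob p ≤ prob r := by
  classical
  unfold prob
  gcongr with a
  exact h a

theorem prob_or_le (p r : α → Prop) : prob (fun a => p a ∨ r a) ≤ prob p + prob r := by
  classical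
  rw [prob_eq_card_div, prob_eq_card_div p, prob_eq_card_div r, ← add_div, Finset.filter_or]
  gcongr
  exact_mod_cast Finset.card_union_le _ _

theorem prob_exists_mem_le {ι : Type*} (s : Finset ι) (p : ι → α → Prop) :
    prob (fun a => ∃ i ∈ s, p i a) ≤ ∑ i ∈ s, prob (p i) := by
  classical
  induction s using Finset.induction_on with
  | empty => simp [prob]
  | insert i s hi ih =>
    rw [Finset.sum_insert hi]
    refine le_trans ?_ ((prob_or_le _ _).trans (add_le_add le_rfl ih))
    refine prob_mono fun a => ?_
    simp

theorem prob_exists_le {ι : Type*} [Fintype ι] (p : ι → α → Prop) :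
    prob (fun a => ∃ i, p i a) ≤ ∑ i, prob (p i) := by
  simpa using prob_exists_mem_le Finset.univ p

theorem prob_not [Nonempty α] (p : α → Prop) : prob (fun a => ¬ p a) = 1 - prob p := by
  classical
  have h : (Fintype.card α : ℝ) ≠ 0 := by
    exact_mod_cast Fintype.card_ne_zero
  rw [prob_eq_card_div, prob_eq_card_div p]
  rw [eq_sub_iff_add_eq, ← add_div, div_eq_one_iff_eq h]
  have := Finset.card_filter_add_card_filter_not (s := (Finset.univ : Finset α)) p
  rw [add_comm, Finset.card_univ] at this
  exact_mod_cast this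

theorem exists_not_of_prob_lt_one [Nonempty α] {p : α → Prop} (h : prob p < 1) : ∃ a, ¬ p a := by
  by_contra! hp
  have h2 := prob_not p
  have h3 : prob (fun a => ¬ p a) = 0 := by simp [prob, hp]
  linarith

theorem prob_prod (p : α × β → Prop) :
    prob p = (∑ b, prob fun a => p (a, b)) / Fintype.card β := by
  classical
  unfold prob
  rw [← Finset.sum_div, div_div, Fintype.card_prod, Nat.cast_mul]
  congr 1
  rw [← Nat.cast_sum, Finset.card_filter, Fintype.sum_prod_type_right]
  simp only [Finset.card_filter]

theorem exists_prob_section_le [Nonempty β] (p : α × β → Prop) :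
    ∃ b, prob (fun a => p (a, b)) ≤ prob p := by
  by_contra! h
  have h0 : (0 : ℝ) < Fintype.card β := by exact_mod_cast Fintype.card_pos
  have := Finset.sum_lt_sum_of_nonempty (s := (Finset.univ : Finset β)) Finset.univ_nonempty
    (fun b _ => h b)
  rw [Finset.sum_const, Finset.card_univ, nsmul_eq_mul] at this
  rw [prob_prod, mul_div_cancel₀ _ h0.ne'] at this
  exact lt_irrefl _ this

/-- A translate of a surjective homomorphism of finite groups maps the uniform distribution to the
uniform distribution. -/
theorem prob_comp_of_surjective {G H : Type*} [AddCommGroup G] [AddCommGroup H] [Fintype G]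
    [Fintype H] (π : G → H) (hadd : ∀ a b, π (a + b) = π a + π b)
    (hsurj : Function.Surjective π) (h₀ : H) (p : H → Prop) :
    prob (fun g => p (h₀ + π g)) = prob p := by
  classical
  let φ : G →+ H := AddMonoidHom.mk' π hadd
  have hfib (h : H) : (Finset.univ.filter fun g => h₀ + π g = h).card
      = (Finset.univ.filter fun g => π g = 0).card := by
    have := AddMonoidHom.card_fiber_eq_of_mem_range φ (x := h - h₀) (y := 0) (hsurj _) (hsurj _)
    refine Eq.trans ?_ this
    congr 1
    ext g
    simp only [Finset.mem_filter, Finset.mem_univ, true_and]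
    rw [eq_sub_iff_add_eq, add_comm]
    rfl
  set c := (Finset.univ.filter fun g => π g = 0).card
  have hcount (s : Finset H) : (Finset.univ.filter fun g => h₀ + π g ∈ s).card = s.card * c := by
    rw [Finset.card_eq_sum_card_fiberwise (f := fun g => h₀ + π g) (t := s)]
    · rw [← smul_eq_mul, ← Finset.sum_const]
      refine Finset.sum_congr rfl fun h hh => ?_
      rw [← hfib h, Finset.filter_filter]
      congr 1
      ext g
      simp only [Finset.mem_filter, Finset.mem_univ, true_and]
      constructor
      · exact fun h => h.2
      · rintro rfl; exact ⟨hh, rfl⟩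
    · intro g hg
      simpa using hg
  have h1 := hcount (Finset.univ.filter p)
  have h2 := hcount Finset.univ
  simp only [Finset.mem_univ, Finset.filter_true, Finset.card_univ] at h2
  simp only [Finset.mem_filter, Finset.mem_univ, true_and] at h1
  unfold prob
  have hG : (0 : ℝ) < Fintype.card G := by exact_mod_cast Fintype.card_pos
  rw [h1, h2]
  rw [h2] at hG
  push_cast at hG ⊢
  have hc : (c : ℝ) ≠ 0 := by rintro h; simp [h] at hG
  rw [mul_div_mul_right _ _ hc]

end UniformProbability

/-! ### Self-correction: far functions violate many subspaces -/

section SelfCorrection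

variable {F : Type*} [Field F] [Fintype F]

section AffineMapOf

variable {W : Type*} [AddCommGroup W] [Module F W] {k : ℕ}

omit [Fintype F] in
@[simp] theorem affineMapOf_zero (b : W) (M : Fin k → W) : affineMapOf b M (0 : Fin k → F) = b := by
  simp [affineMapOf]

-- One invertible coordinate of `y` suffices. This gives the surjectivity that makes points at
-- nonzero `y` uniform, and is why `y = 0` is treated apart below.
omit [Fintype F] in
theorem exists_sum_smul_eq {y : Fin k → F} (hy : y ≠ 0) (w : W) :
    ∃ M : Fin k → W, ∑ i, y i • M i = w := by
  obtain ⟨i, hi⟩ := Function.ne_iff.1 hy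
  refine ⟨Pi.single i ((y i)⁻¹ • w), ?_⟩
  rw [Finset.sum_eq_single i]
  · simp only [Pi.single_eq_same]
    rw [smul_smul, mul_inv_cancel₀ hi, one_smul]
  · intro j _ hj
    simp [hj]
  · simp

omit [Fintype F] in
theorem sum_smul_add (y : Fin k → F) (M N : Fin k → W) :
    ∑ i, y i • (M + N) i = ∑ i, y i • M i + ∑ i, y i • N i := by
  simp [Finset.sum_add_distrib]

omit [Fintype F] in
theorem affineMapOf_comm (x : W) (A B : Fin k → W) (y z : Fin k → F) :
    affineMapOf (affineMapOf x B z) A y = affineMapOf (affineMapOf x A y) B z := by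
  simp only [affineMapOf]
  abel

end AffineMapOf

variable {n : ℕ}

/-- The restriction of `f` along the affine map `T` has degree greater than `d`. -/
def IsViolated (d : ℕ) (f : (Fin n → F) → F)
    (T : (Fin n → F) × (Fin (d + 1) → Fin n → F)) : Prop :=
  (fun y => f (affineMapOf T.1 T.2 y)) ∉ reedMuller F (d + 1) d

/-- The rejection probability of the basic low-degree test. -/
noncomputable def rejProb (d : ℕ) (f : (Fin n → F) → F) : ℝ := prob (IsViolated d f)

open Classical in
/-- The value at `x` interpolated from the other points of the affine subspace `x + range A`. -/
noncomputable def interpolatedValue {k : ℕ} (f : (Fin n → F) → F) (x : Fin n → F)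
    (A : Fin k → Fin n → F) : F :=
  -∑ y ∈ Finset.univ.erase (0 : Fin k → F), f (affineMapOf x A y)

theorem sum_affineMapOf_eq {k : ℕ} (f : (Fin n → F) → F) (x : Fin n → F)
    (A : Fin k → Fin n → F) :
    ∑ y : Fin k → F, f (affineMapOf x A y) = f x - interpolatedValue f x A := by
  classical
  rw [interpolatedValue, sub_neg_eq_add, ← Finset.add_sum_erase _ _ (Finset.mem_univ 0),
    affineMapOf_zero]

variable {d : ℕ} (f : (Fin n → F) → F)

theorem sum_eq_zero_of_not_isViolated {f : (Fin n → F) → F} {x : Fin n → F}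
    {A : Fin (d + 1) → Fin n → F} (h : ¬ IsViolated d f (x, A)) :
    ∑ y : Fin (d + 1) → F, f (affineMapOf x A y) = 0 :=
  sum_eq_zero_of_mem_reedMuller (not_not.1 h)

theorem prob_isViolated_left (x : Fin n → F) {y : Fin (d + 1) → F} (hy : y ≠ 0) :
    prob (fun AB : (Fin (d + 1) → Fin n → F) × (Fin (d + 1) → Fin n → F) =>
      IsViolated d f (affineMapOf x AB.1 y, AB.2)) = rejProb d f := by
  rw [rejProb, ← prob_comp_of_surjective (fun AB : (Fin (d + 1) → Fin n → F) ×
    (Fin (d + 1) → Fin n → F) => (∑ i, y i • AB.1 i, AB.2)) ?_ ?_ (x, 0)]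
  · simp only [Prod.mk_add_mk, zero_add, affineMapOf]
  · intro a b
    simp only [Prod.fst_add, Prod.snd_add, sum_smul_add, Prod.mk_add_mk]
  · rintro ⟨w, B⟩
    obtain ⟨M, hM⟩ := exists_sum_smul_eq hy w
    exact ⟨(M, B), by simp [hM]⟩

theorem prob_isViolated_right (x : Fin n → F) {y : Fin (d + 1) → F} (hy : y ≠ 0) :
    prob (fun AB : (Fin (d + 1) → Fin n → F) × (Fin (d + 1) → Fin n → F) =>
      IsViolated d f (affineMapOf x AB.2 y, AB.1)) = rejProb d f := by
  rw [rejProb, ← prob_comp_of_surjective (fun AB : (Fin (d + 1) → Fin n → F) ×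
    (Fin (d + 1) → Fin n → F) => (∑ i, y i • AB.2 i, AB.1)) ?_ ?_ (x, 0)]
  · simp only [Prod.mk_add_mk, zero_add, affineMapOf]
  · intro a b
    simp only [Prod.fst_add, Prod.snd_add, sum_smul_add, Prod.mk_add_mk]
  · rintro ⟨w, B⟩
    obtain ⟨M, hM⟩ := exists_sum_smul_eq hy w
    exact ⟨(B, M), by simp [hM]⟩

theorem rejProb_nonneg : 0 ≤ rejProb d f := prob_nonneg _

theorem sum_erase_zero_rejProb_le [DecidableEq (Fin (d + 1) → F)] :
    ∑ _y ∈ Finset.univ.erase (0 : Fin (d + 1) → F), rejProb d f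
      ≤ (Fintype.card F : ℝ) ^ (d + 1) * rejProb d f := by
  rw [Finset.sum_const, nsmul_eq_mul]
  refine mul_le_mul_of_nonneg_right ?_ (rejProb_nonneg f)
  have : (Finset.univ.erase (0 : Fin (d + 1) → F)).card ≤ Fintype.card F ^ (d + 1) := by
    refine (Finset.card_erase_le).trans ?_
    simp
  exact_mod_cast this

/-- Two random interpolations of the value at `x` agree with high probability. -/
theorem prob_interpolatedValue_ne_le (x : Fin n → F) :
    prob (fun AB : (Fin (d + 1) → Fin n → F) × (Fin (d + 1) → Fin n → F) =>
      interpolatedValue f x AB.1 ≠ interpolatedValue f x AB.2)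
      ≤ 2 * (Fintype.card F : ℝ) ^ (d + 1) * rejProb d f := by
  classical
  let s := Finset.univ.erase (0 : Fin (d + 1) → F)
  have key : ∀ AB : (Fin (d + 1) → Fin n → F) × (Fin (d + 1) → Fin n → F),
      interpolatedValue f x AB.1 ≠ interpolatedValue f x AB.2 →
      (∃ y ∈ s, IsViolated d f (affineMapOf x AB.1 y, AB.2)) ∨
      (∃ y ∈ s, IsViolated d f (affineMapOf x AB.2 y, AB.1)) := by
    rintro ⟨A, B⟩ hne
    by_contra! h
    apply hne
    -- Sum `f` over the grid `x + A y + B z`. If all rows `y ≠ 0` and columns `z ≠ 0` sum to zero,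
    -- the total equals both the row `y = 0` and the column `z = 0`, which forces the two
    -- interpolations to agree.
    have row : ∑ y : Fin (d + 1) → F, ∑ z : Fin (d + 1) → F, f (affineMapOf (affineMapOf x A y) B z) =
        ∑ z : Fin (d + 1) → F, f (affineMapOf x B z) := by
      rw [← Finset.add_sum_erase _ _ (Finset.mem_univ 0), affineMapOf_zero,
        Finset.sum_eq_zero fun y hy => sum_eq_zero_of_not_isViolated (h.1 y hy), add_zero]
    have col : ∑ z : Fin (d + 1) → F, ∑ y : Fin (d + 1) → F, f (affineMapOf (affineMapOf x B z) A y) =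
        ∑ y : Fin (d + 1) → F, f (affineMapOf x A y) := by
      rw [← Finset.add_sum_erase _ _ (Finset.mem_univ 0), affineMapOf_zero,
        Finset.sum_eq_zero fun y hy => sum_eq_zero_of_not_isViolated (h.2 y hy), add_zero]
    rw [Finset.sum_comm] at col
    simp only [affineMapOf_comm] at col
    rw [row, sum_affineMapOf_eq, sum_affineMapOf_eq] at col
    simpa using col.symm
  refine (prob_mono key).trans ((prob_or_le _ _).trans ?_)
  have h1 := prob_exists_mem_le s fun y (AB : (Fin (d + 1) → Fin n → F) × (Fin (d + 1) → Fin n → F))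
    => IsViolated d f (affineMapOf x AB.1 y, AB.2)
  have h2 := prob_exists_mem_le s fun y (AB : (Fin (d + 1) → Fin n → F) × (Fin (d + 1) → Fin n → F))
    => IsViolated d f (affineMapOf x AB.2 y, AB.1)
  rw [Finset.sum_congr rfl fun y hy => prob_isViolated_left f x (Finset.ne_of_mem_erase hy)] at h1
  rw [Finset.sum_congr rfl fun y hy => prob_isViolated_right f x (Finset.ne_of_mem_erase hy)] at h2
  have h3 := sum_erase_zero_rejProb_le (d := d) f
  linarith

theorem exists_corrected_value (x : Fin n → F) :
    ∃ v : F, prob (fun A : Fin (d + 1) → Fin n → F => interpolatedValue f x A ≠ v)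
      ≤ 2 * (Fintype.card F : ℝ) ^ (d + 1) * rejProb d f := by
  obtain ⟨B, hB⟩ := exists_prob_section_le
    (fun AB : (Fin (d + 1) → Fin n → F) × (Fin (d + 1) → Fin n → F) =>
      interpolatedValue f x AB.1 ≠ interpolatedValue f x AB.2)
  exact ⟨interpolatedValue f x B, le_trans hB (prob_interpolatedValue_ne_le f x)⟩

/-- The corrected function has degree at most `d`. -/
theorem corrected_mem_reedMuller {η : ℝ} {g : (Fin n → F) → F}
    (hg : ∀ x, prob (fun A : Fin (d + 1) → Fin n → F => interpolatedValue f x A ≠ g x) ≤ η)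
    (h : (Fintype.card F : ℝ) ^ (d + 1) * η + (Fintype.card F : ℝ) ^ (d + 1) * rejProb d f < 1) :
    g ∈ reedMuller F n d := by
  classical
  refine mem_reedMuller_of_affine_restrictions fun b M => ?_
  -- A random bilinear grid `b + M y + N z + B (y, z)`. Row `y` interpolates `g` at `b + M y` in a
  -- uniform direction `L NB y`; column `z ≠ 0` is a uniform subspace `C NB z`. If no row fails and
  -- no such column is violated, `g` along `(b, M)` is minus a sum of column restrictions, each of
  -- degree at most `d`.
  let L (NB : (Fin (d + 1) → Fin n → F) × (Fin (d + 1) → Fin (d + 1) → Fin n → F))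
      (y : Fin (d + 1) → F) : Fin (d + 1) → Fin n → F := NB.1 + ∑ l, y l • NB.2 l
  let C (NB : (Fin (d + 1) → Fin n → F) × (Fin (d + 1) → Fin (d + 1) → Fin n → F))
      (z : Fin (d + 1) → F) : (Fin n → F) × (Fin (d + 1) → Fin n → F) :=
    (affineMapOf b NB.1 z, fun l => affineMapOf (M l) (NB.2 l) z)
  have hrow (y : Fin (d + 1) → F) : prob (fun NB => interpolatedValue f (affineMapOf b M y) (L NB y)
      ≠ g (affineMapOf b M y)) ≤ η := by
    refine le_trans (le_of_eq ?_) (hg (affineMapOf b M y))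
    rw [← prob_comp_of_surjective (fun NB => L NB y) ?_ ?_ 0]
    · simp only [zero_add]
    · intro P Q
      simp only [L, Prod.fst_add, Prod.snd_add, sum_smul_add]
      abel
    · intro A
      exact ⟨(A, 0), by simp [L]⟩
  have hcol (z : Fin (d + 1) → F) (hz : z ≠ 0) :
      prob (fun NB => IsViolated d f (C NB z)) = rejProb d f := by
    rw [rejProb, ← prob_comp_of_surjective
      (fun NB : (Fin (d + 1) → Fin n → F) × (Fin (d + 1) → Fin (d + 1) → Fin n → F) =>
        (∑ i, z i • NB.1 i, fun l => ∑ i, z i • NB.2 l i)) ?_ ?_ (b, M)]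
    · rfl
    · intro P Q
      refine Prod.ext (sum_smul_add z P.1 Q.1) (funext fun l => ?_)
      exact sum_smul_add z (P.2 l) (Q.2 l)
    · rintro ⟨w, B⟩
      obtain ⟨N, hN⟩ := exists_sum_smul_eq hz w
      choose B' hB' using fun l => exists_sum_smul_eq hz (B l)
      exact ⟨(N, B'), by simp [hN, hB']⟩
  have hlt : prob (fun NB => (∃ y : Fin (d + 1) → F,
      interpolatedValue f (affineMapOf b M y) (L NB y) ≠ g (affineMapOf b M y)) ∨
      ∃ z ∈ Finset.univ.erase (0 : Fin (d + 1) → F), IsViolated d f (C NB z)) < 1 := by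
    refine lt_of_le_of_lt (prob_or_le _ _) ?_
    have h1 := (prob_exists_le fun (y : Fin (d + 1) → F) NB =>
      interpolatedValue f (affineMapOf b M y) (L NB y)
        ≠ g (affineMapOf b M y)).trans (Finset.sum_le_sum fun y _ => hrow y)
    have h2 := prob_exists_mem_le (Finset.univ.erase (0 : Fin (d + 1) → F))
      fun z NB => IsViolated d f (C NB z)
    rw [Finset.sum_congr rfl fun z hz => hcol z (Finset.ne_of_mem_erase hz)] at h2
    have h3 := sum_erase_zero_rejProb_le (d := d) f
    rw [Finset.sum_const, Finset.card_univ, nsmul_eq_mul, Fintype.card_fun, Fintype.card_fin,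
      Nat.cast_pow] at h1
    linarith
  obtain ⟨NB, hNB⟩ := exists_not_of_prob_lt_one hlt
  push Not at hNB
  have hgeq : (fun y : Fin (d + 1) → F => g (affineMapOf b M y)) = fun y =>
      -∑ z ∈ Finset.univ.erase (0 : Fin (d + 1) → F),
        f (affineMapOf (C NB z).1 (C NB z).2 y) := by
    funext y
    rw [← hNB.1 y, interpolatedValue]
    congr 1
    refine Finset.sum_congr (by congr) fun z _ => ?_
    refine congrArg f ?_
    simp only [affineMapOf, L, C, Pi.add_apply, Finset.sum_apply, Pi.smul_apply, smul_add,
      Finset.sum_add_distrib, Finset.smul_sum]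
    rw [Finset.sum_comm]
    simp only [smul_comm (_ : F) (_ : F)]
    abel
  rw [hgeq]
  exact reedMuller_neg_mem (reedMuller_sum_mem _ fun z hz => not_not.1 (hNB.2 z hz))

/-- The corrected function is close to the original one. -/
theorem prob_ne_corrected_le {g : (Fin n → F) → F}
    (hg : ∀ x, prob (fun A : Fin (d + 1) → Fin n → F => interpolatedValue f x A ≠ g x) ≤ 1 / 2) :
    prob (fun x => f x ≠ g x) ≤ 2 * rejProb d f := by
  classical
  -- An unviolated subspace through `x` interpolates to `f x`, which differs from `g x`; this
  -- happens at most half the time. Averaging over `x` then gives the bound.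
  have hpoint (x) (hx : f x ≠ g x) : 1 / 2 ≤ prob fun A => IsViolated d f (x, A) := by
    have h1 : prob (fun A : Fin (d + 1) → Fin n → F => ¬ IsViolated d f (x, A)) ≤ 1 / 2 := by
      refine (prob_mono fun A hA => ?_).trans (hg x)
      have := sum_eq_zero_of_not_isViolated hA
      rw [sum_affineMapOf_eq, sub_eq_zero] at this
      rwa [← this]
    rw [prob_not] at h1
    linarith
  have hswap : rejProb d f
      = (∑ x, prob fun A => IsViolated d f (x, A)) / Fintype.card (Fin n → F) := by
    rw [rejProb, ← prob_prod (fun T : (Fin (d + 1) → Fin n → F) × (Fin n → F) =>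
      IsViolated d f (T.2, T.1)), prob_eq_card_div, prob_eq_card_div, Fintype.card_prod,
      Fintype.card_prod, mul_comm (Fintype.card (Fin n → F))]
    congr 2
    refine Finset.card_equiv (Equiv.prodComm _ _) ?_
    simp
  rw [hswap, prob_eq_card_div, ← mul_div_assoc]
  gcongr
  rw [Finset.card_filter]
  push_cast
  rw [Finset.mul_sum]
  refine Finset.sum_le_sum fun x _ => ?_
  have := prob_nonneg fun A => IsViolated d f (x, A)
  split_ifs with hx
  · linarith [hpoint x hx]
  · positivity

/-- If the basic test rejects `f` with small probability, then `f` is close to degree `d`. -/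
theorem exists_close_of_rejProb_small
    (h : 3 * ((Fintype.card F : ℝ) ^ (d + 1)) ^ 2 * rejProb d f < 1) :
    ∃ g ∈ reedMuller F n d, prob (fun x => f x ≠ g x) ≤ 2 * rejProb d f := by
  have hρ := rejProb_nonneg (d := d) f
  have hq : (2 : ℝ) ≤ Fintype.card F := by exact_mod_cast Fintype.one_lt_card (α := F)
  have hK2 : 2 ≤ (Fintype.card F : ℝ) ^ (d + 1) :=
    hq.trans (le_self_pow₀ (by linarith) (by omega))
  choose g hg using exists_corrected_value (d := d) f
  -- The error of `g` is `η = 2 K ρ`, so `K η + K ρ ≤ 3 K ^ 2 ρ`; and `2 K ρ ≤ K ^ 2 ρ < 1 / 3`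
  -- because `K ≥ 2`.
  have key : ∀ K : ℝ, 2 ≤ K → 3 * K ^ 2 * rejProb d f < 1 →
      K * (2 * K * rejProb d f) + K * rejProb d f < 1 ∧ 2 * K * rejProb d f ≤ 1 / 2 := by
    intro K hK h
    have : K * rejProb d f ≤ K ^ 2 * rejProb d f :=
      mul_le_mul_of_nonneg_right (by nlinarith) hρ
    constructor <;> nlinarith
  obtain ⟨h1, h2⟩ := key _ hK2 h
  exact ⟨g, corrected_mem_reedMuller f hg h1, prob_ne_corrected_le f fun x => (hg x).trans h2⟩

omit [Field F] in
theorem fracDist_eq_prob [DecidableEq F] (f g : (Fin n → F) → F) :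
    fracDist f g = prob fun x => f x ≠ g x := by
  classical
  rw [fracDist, prob_eq_card_div, hammingDist]

theorem rejProb_ge_of_isFarFromDegree [DecidableEq F] {δ : ℝ} (hδ : δ ≤ 1)
    (hf : IsFarFromDegree δ d f) :
    δ / (3 * ((Fintype.card F : ℝ) ^ (d + 1)) ^ 2) ≤ rejProb d f := by
  have hq : (2 : ℝ) ≤ Fintype.card F := by exact_mod_cast Fintype.one_lt_card (α := F)
  have hρ := rejProb_nonneg (d := d) f
  have hK : 1 ≤ ((Fintype.card F : ℝ) ^ (d + 1)) ^ 2 :=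
    one_le_pow₀ (one_le_pow₀ (by linarith))
  rw [div_le_iff₀ (by positivity)]
  by_cases h : 3 * ((Fintype.card F : ℝ) ^ (d + 1)) ^ 2 * rejProb d f < 1
  · obtain ⟨g, hg, hfg⟩ := exists_close_of_rejProb_small f h
    have := hf g hg
    rw [fracDist_eq_prob] at this
    nlinarith
  · linarith

end SelfCorrection

/-! ### Chebyshev's inequality for pairwise independent events -/

section SecondMoment

variable {α β : Type*} [Fintype α] [Fintype β]

theorem prob_and_prod (p : α → Prop) (r : β → Prop) :
    prob (fun ab : α × β => p ab.1 ∧ r ab.2) = prob p * prob r := by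
  classical
  rw [prob_eq_card_div, prob_eq_card_div p, prob_eq_card_div r, ← Finset.univ_product_univ,
    Finset.filter_product, Finset.card_product, Fintype.card_prod]
  push_cast
  rw [div_mul_div_comm]

theorem sum_indicator_eq_card_mul_prob [Nonempty α] (p : α → Prop) [DecidablePred p] :
    (∑ a, if p a then (1 : ℝ) else 0) = Fintype.card α * prob p := by
  have h : (Fintype.card α : ℝ) ≠ 0 := by exact_mod_cast Fintype.card_ne_zero
  rw [prob_eq_card_div, mul_div_cancel₀ _ h, Finset.sum_boole]

/-- Chebyshev's inequality for the number of pairwise independent events that occur. -/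
theorem prob_few_events_le {J : Type*} [Fintype J] [Nonempty J] [Nonempty α] (E : J → α → Prop)
    {ρ : ℝ} (hρ : 0 < ρ) (h1 : ∀ j, prob (E j) = ρ)
    (h2 : ∀ i j, i ≠ j → prob (fun a => E i a ∧ E j a) = ρ * ρ) :
    prob (fun a => 2 * prob (fun j => E j a) < ρ) ≤ 4 / (Fintype.card J * ρ) := by
  classical
  set c : ℝ := (Fintype.card J : ℝ) with hc
  set w : ℝ := (Fintype.card α : ℝ) with hw
  have hc0 : 0 < c := by rw [hc]; exact_mod_cast Fintype.card_pos
  have hw0 : 0 < w := by rw [hw]; exact_mod_cast Fintype.card_pos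
  let X (j : J) (a : α) : ℝ := if E j a then 1 else 0
  have hX (j) : ∑ a, X j a = w * ρ := by
    rw [← h1 j]; exact sum_indicator_eq_card_mul_prob _
  have hXX (i j) (hij : i ≠ j) : ∑ a, X i a * X j a = w * (ρ * ρ) := by
    rw [← h2 i j hij, hw, ← sum_indicator_eq_card_mul_prob]
    refine Finset.sum_congr rfl fun a _ => ?_
    by_cases hi : E i a <;> by_cases hj : E j a <;> simp [X, hi, hj]
  have hXsq (j a) : X j a * X j a = X j a := by
    by_cases hj : E j a <;> simp [X, hj]
  have hcov (i j) : ∑ a, (X i a - ρ) * (X j a - ρ) ≤ if i = j then w * ρ else 0 := by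
    have hexp : ∑ a, (X i a - ρ) * (X j a - ρ) = ∑ a, X i a * X j a - w * (ρ * ρ) := by
      have : ∀ a, (X i a - ρ) * (X j a - ρ)
          = X i a * X j a - ρ * X i a - ρ * X j a + ρ * ρ := fun a => by ring
      simp only [this, Finset.sum_add_distrib, Finset.sum_sub_distrib, ← Finset.mul_sum, hX,
        Finset.sum_const, Finset.card_univ, nsmul_eq_mul, ← hw]
      ring
    rw [hexp]
    split_ifs with hij
    · subst hij
      simp only [hXsq, hX]
      nlinarith [mul_pos hw0 (mul_pos hρ hρ)]
    · rw [hXX i j hij, sub_self]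
  have hvar : ∑ a, (∑ j, (X j a - ρ)) ^ 2 ≤ c * (w * ρ) := by
    have : ∀ a, (∑ j, (X j a - ρ)) ^ 2 = ∑ i, ∑ j, (X i a - ρ) * (X j a - ρ) := fun a => by
      rw [sq, Finset.sum_mul_sum]
    simp only [this]
    rw [Finset.sum_comm]
    calc ∑ i, ∑ a, ∑ j, (X i a - ρ) * (X j a - ρ)
        = ∑ i, ∑ j, ∑ a, (X i a - ρ) * (X j a - ρ) :=
          Finset.sum_congr rfl fun i _ => Finset.sum_comm
      _ ≤ ∑ i : J, ∑ j, if i = j then w * ρ else 0 :=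
          Finset.sum_le_sum fun i _ => Finset.sum_le_sum fun j _ => hcov i j
      _ = c * (w * ρ) := by simp [hc]
  -- With fewer than half the expected events, the centred sum is below `-c ρ / 2`. Comparing
  -- squares with the variance bound `c ρ` gives `4 / (c ρ)`.
  have hlow : ∀ a, (if 2 * prob (fun j => E j a) < ρ then (1 : ℝ) else 0) * (c * ρ / 2) ^ 2
      ≤ (∑ j, (X j a - ρ)) ^ 2 := by
    intro a
    split_ifs with ha
    · have hs : ∑ j, (X j a - ρ) = c * prob (fun j => E j a) - c * ρ := by
        rw [Finset.sum_sub_distrib, Finset.sum_const, Finset.card_univ, nsmul_eq_mul, ← hc]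
        congr 1
        exact sum_indicator_eq_card_mul_prob _
      rw [hs, one_mul]
      have : c * ρ / 2 ≤ c * ρ - c * prob (fun j => E j a) := by nlinarith
      have h0 : 0 ≤ c * ρ / 2 := by positivity
      nlinarith
    · rw [zero_mul]; positivity
  have hfin := (Finset.sum_le_sum fun a (_ : a ∈ Finset.univ) => hlow a).trans hvar
  rw [← Finset.sum_mul, sum_indicator_eq_card_mul_prob, ← hw] at hfin
  rw [le_div_iff₀ (by positivity)]
  set p := prob fun a => 2 * prob (fun j => E j a) < ρ
  have h3 : (w * (c * ρ)) * (p * (c * ρ)) ≤ (w * (c * ρ)) * 4 := by nlinarith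
  exact le_of_mul_le_mul_left h3 (by positivity)

end SecondMoment

/-! ### Random surfaces -/

section RandomSurface

variable {F : Type*} [Field F] [Fintype F]

section Pairwise

variable {W : Type*} [AddCommGroup W] [Module F W] [Fintype W] {r : ℕ}

omit [Fintype F] in
theorem prob_affineMapOf (v : Fin r → F) (p : W → Prop) :
    prob (fun ψ : W × (Fin r → W) => p (affineMapOf ψ.1 ψ.2 v)) = prob p := by
  rw [← prob_comp_of_surjective
    (fun ψ : W × (Fin r → W) => ψ.1 + ∑ i, v i • ψ.2 i) ?_ ?_ 0 p]
  · simp only [zero_add]; rfl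
  · intro a b
    simp only [Prod.fst_add, Prod.snd_add, sum_smul_add]
    abel
  · intro w
    exact ⟨(w, 0), by simp⟩

omit [Fintype F] in
/-- The values of a random affine map at two distinct points are independent and uniform. -/
theorem prob_affineMapOf_pair {v v' : Fin r → F} (h : v ≠ v') (p : W × W → Prop) :
    prob (fun ψ : W × (Fin r → W) => p (affineMapOf ψ.1 ψ.2 v, affineMapOf ψ.1 ψ.2 v'))
      = prob p := by
  rw [← prob_comp_of_surjective
    (fun ψ : W × (Fin r → W) => (ψ.1 + ∑ i, v i • ψ.2 i, ψ.1 + ∑ i, v' i • ψ.2 i)) ?_ ?_ 0 p]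
  · simp only [zero_add]; rfl
  · intro a b
    simp only [Prod.fst_add, Prod.snd_add, sum_smul_add, Prod.mk_add_mk]
    congr 1 <;> abel
  · rintro ⟨w, w'⟩
    obtain ⟨M, hM⟩ := exists_sum_smul_eq (sub_ne_zero.2 h.symm) (w' - w)
    simp only [Pi.sub_apply, sub_smul, Finset.sum_sub_distrib] at hM
    refine ⟨(w - ∑ i, v i • M i, M), Prod.ext (by simp) ?_⟩
    simp only
    rw [sub_add_eq_add_sub, add_sub_assoc, hM, add_sub_cancel]

end Pairwise

variable {n d r : ℕ}

/-- The parameters of a random surface: an affine family, parametrized by `F ^ r`, of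
`(d + 1)`-dimensional parametrized affine subspaces of `F ^ n`. -/
abbrev SurfaceParam (F : Type*) (n d r : ℕ) : Type _ :=
  ((Fin n → F) × (Fin (d + 1) → Fin n → F)) × (Fin r → (Fin n → F) × (Fin (d + 1) → Fin n → F))

/-- The point with coordinates `y` of the affine subspace with parameter `v`. -/
def surfacePoint (ψ : SurfaceParam F n d r) (u : (Fin (d + 1) → F) × (Fin r → F)) : Fin n → F :=
  affineMapOf (affineMapOf ψ.1 ψ.2 u.2).1 (affineMapOf ψ.1 ψ.2 u.2).2 u.1

/-- A surface that meets the violations of `f` often and on which points seldom coincide. -/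
structure IsGoodSurface (f : (Fin n → F) → F) (ψ : SurfaceParam F n d r) : Prop where
  violated : rejProb d f ≤ 2 * prob fun v : Fin r → F => IsViolated d f (affineMapOf ψ.1 ψ.2 v)
  injective : ∀ y, Function.Injective fun v => surfacePoint ψ (y, v)

theorem prob_eq_pointwise {α : Type*} [Fintype α] (a : α) :
    prob (fun b : α => b = a) = 1 / Fintype.card α := by
  classical
  rw [prob_eq_card_div, Finset.filter_eq' Finset.univ a]
  simp

/-- For `v ≠ v'` the two subspaces are independent and uniform, so the difference of their points at
`y` is uniform on `F ^ n`. -/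
theorem prob_surfacePoint_eq (y : Fin (d + 1) → F) {v v' : Fin r → F} (h : v ≠ v') :
    prob (fun ψ : SurfaceParam F n d r => surfacePoint ψ (y, v) = surfacePoint ψ (y, v'))
      = 1 / (Fintype.card F : ℝ) ^ n := by
  have hpair := prob_affineMapOf_pair (W := (Fin n → F) × (Fin (d + 1) → Fin n → F)) h
    fun TT => affineMapOf TT.1.1 TT.1.2 y = affineMapOf TT.2.1 TT.2.2 y
  refine hpair.trans ?_
  have hcard : (Fintype.card F : ℝ) ^ n = Fintype.card (Fin n → F) := by simp
  rw [hcard, ← prob_eq_pointwise (0 : Fin n → F), ← prob_comp_of_surjective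
    (fun TT : ((Fin n → F) × (Fin (d + 1) → Fin n → F)) ×
      ((Fin n → F) × (Fin (d + 1) → Fin n → F)) =>
      affineMapOf TT.1.1 TT.1.2 y - affineMapOf TT.2.1 TT.2.2 y) ?_ ?_ 0]
  · simp only [zero_add, sub_eq_zero]
  · intro a b
    simp only [affineMapOf, Prod.fst_add, Prod.snd_add, sum_smul_add]
    abel
  · intro w
    exact ⟨((w, 0), 0), by simp [affineMapOf]⟩

/-- The first term is Chebyshev over the `q ^ r` subspaces; the second is a union bound over
coincidences, indexed by triples `(y, v, v')`. -/
theorem prob_not_isGoodSurface_le (f : (Fin n → F) → F) (hf : 0 < rejProb d f) :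
    prob (fun ψ : SurfaceParam F n d r => ¬ IsGoodSurface f ψ)
      ≤ 4 / ((Fintype.card F : ℝ) ^ r * rejProb d f)
        + (Fintype.card F : ℝ) ^ (d + 1 + 2 * r) / (Fintype.card F : ℝ) ^ n := by
  classical
  have h1 : prob (fun ψ : SurfaceParam F n d r =>
      2 * prob (fun v : Fin r → F => IsViolated d f (affineMapOf ψ.1 ψ.2 v)) < rejProb d f)
      ≤ 4 / ((Fintype.card F : ℝ) ^ r * rejProb d f) := by
    have := prob_few_events_le (α := SurfaceParam F n d r)
      (fun (v : Fin r → F) ψ => IsViolated d f (affineMapOf ψ.1 ψ.2 v)) hf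
      (fun v => prob_affineMapOf v _) (fun v v' hv => by
        rw [prob_affineMapOf_pair hv fun TT => IsViolated d f TT.1 ∧ IsViolated d f TT.2,
          prob_and_prod]
        rfl)
    simpa using this
  have h2 : prob (fun ψ : SurfaceParam F n d r => ∃ yvv : (Fin (d + 1) → F) × (Fin r → F) ×
      (Fin r → F), yvv.2.1 ≠ yvv.2.2 ∧ surfacePoint ψ (yvv.1, yvv.2.1)
        = surfacePoint ψ (yvv.1, yvv.2.2))
      ≤ (Fintype.card F : ℝ) ^ (d + 1 + 2 * r) / (Fintype.card F : ℝ) ^ n := by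
    refine (prob_exists_le _).trans ?_
    calc _ ≤ ∑ _yvv : (Fin (d + 1) → F) × (Fin r → F) × (Fin r → F),
          1 / (Fintype.card F : ℝ) ^ n := by
          refine Finset.sum_le_sum fun yvv _ => ?_
          by_cases hv : yvv.2.1 = yvv.2.2
          · simp only [hv, ne_eq, not_true_eq_false, false_and]
            simp only [prob, Finset.filter_false, Finset.card_empty, Nat.cast_zero, zero_div]
            positivity
          · rw [← prob_surfacePoint_eq yvv.1 hv]
            exact prob_mono fun ψ hψ => hψ.2
      _ = _ := by
          rw [Finset.sum_const, Finset.card_univ, nsmul_eq_mul]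
          simp only [Fintype.card_prod, Fintype.card_fun, Fintype.card_fin]
          push_cast
          ring
  refine (prob_mono fun ψ hψ => ?_).trans ((prob_or_le _ _).trans (add_le_add h1 h2))
  by_contra! h
  refine hψ ⟨h.1, fun y v v' hv => ?_⟩
  by_contra hne
  exact h.2 (y, v, v') hne hv

/-- On a violated subspace `f` cannot agree with `g` everywhere, so they differ at one or more of
its `q ^ (d + 1)` parameters. -/
theorem prob_surface_ne_ge {f : (Fin n → F) → F} {ψ : SurfaceParam F n d r}
    (hψ : IsGoodSurface f ψ) {g : (Fin n → F) → F} (hg : g ∈ reedMuller F n d) :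
    rejProb d f / (2 * (Fintype.card F : ℝ) ^ (d + 1))
      ≤ prob fun u => f (surfacePoint ψ u) ≠ g (surfacePoint ψ u) := by
  classical
  have hq : (0 : ℝ) < Fintype.card F := by exact_mod_cast Fintype.card_pos
  have hv (v : Fin r → F) (h : IsViolated d f (affineMapOf ψ.1 ψ.2 v)) :
      1 / (Fintype.card F : ℝ) ^ (d + 1)
        ≤ prob fun y => f (surfacePoint ψ (y, v)) ≠ g (surfacePoint ψ (y, v)) := by
    obtain ⟨y, hy⟩ : ∃ y, f (surfacePoint ψ (y, v)) ≠ g (surfacePoint ψ (y, v)) := by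
      by_contra! hall
      apply h
      simp only [surfacePoint] at hall
      simp only [hall]
      exact reedMuller_comp_affine_mem hg _ _
    calc 1 / (Fintype.card F : ℝ) ^ (d + 1) = prob (fun b : Fin (d + 1) → F => b = y) := by
          rw [prob_eq_pointwise]; simp
      _ ≤ _ := prob_mono fun b hb => by rw [hb]; exact hy
  rw [prob_prod]
  have hcard : (0 : ℝ) < Fintype.card (Fin r → F) := by exact_mod_cast Fintype.card_pos
  have hsum : (∑ v : Fin r → F, if IsViolated d f (affineMapOf ψ.1 ψ.2 v) then (1 : ℝ) else 0)
      * (1 / (Fintype.card F : ℝ) ^ (d + 1))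
      ≤ ∑ v, prob fun y => f (surfacePoint ψ (y, v)) ≠ g (surfacePoint ψ (y, v)) := by
    rw [Finset.sum_mul]
    refine Finset.sum_le_sum fun v _ => ?_
    split_ifs with h
    · rw [one_mul]; exact hv v h
    · rw [zero_mul]; exact prob_nonneg _
  rw [le_div_iff₀ hcard]
  refine le_trans ?_ hsum
  rw [sum_indicator_eq_card_mul_prob]
  have := hψ.violated
  rw [div_mul_eq_mul_div, mul_one_div, div_le_div_iff₀ (by positivity) (by positivity)]
  have h3 : 0 ≤ (Fintype.card (Fin r → F) : ℝ) * (Fintype.card F : ℝ) ^ (d + 1) := by positivity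
  nlinarith

/-- For each `y`, injectivity in `v` lets at most `E.card` of the `q ^ r` points fall into `E`,
wherever `E` lies. -/
theorem prob_surface_mem_le [DecidableEq (Fin n → F)] {f : (Fin n → F) → F}
    {ψ : SurfaceParam F n d r} (hψ : IsGoodSurface f ψ) (E : Finset (Fin n → F)) :
    prob (fun u => surfacePoint ψ u ∈ E) ≤ E.card / (Fintype.card F : ℝ) ^ r := by
  classical
  have hq : (0 : ℝ) < Fintype.card F := by exact_mod_cast Fintype.card_pos
  have hcount : (Finset.univ.filter fun u => surfacePoint ψ u ∈ E).card
      ≤ Fintype.card (Fin (d + 1) → F) * E.card := by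
    rw [Finset.card_filter, Fintype.sum_prod_type, ← Finset.card_univ, ← smul_eq_mul,
      ← Finset.sum_const]
    refine Finset.sum_le_sum fun y _ => ?_
    rw [← Finset.card_filter]
    exact Finset.card_le_card_of_injOn (fun v => surfacePoint ψ (y, v))
      (fun v hv => by simpa using hv) (hψ.injective y).injOn
  rw [prob_eq_card_div, div_le_div_iff₀ (by positivity) (by positivity)]
  have h2 : ((Finset.univ.filter fun u => surfacePoint ψ u ∈ E).card : ℝ)
      ≤ (Fintype.card F : ℝ) ^ (d + 1) * E.card := by
    exact_mod_cast (by simpa using hcount)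
  simp only [Fintype.card_prod, Fintype.card_fun, Fintype.card_fin]
  push_cast
  have h3 : (0 : ℝ) ≤ (Fintype.card F : ℝ) ^ r := by positivity
  nlinarith

end RandomSurface

/-! ### The consistency test against an adversary -/

section ConsistencyTest

variable {X Y : Type*}

open Classical in
/-- The nonadaptive algorithm that queries the points of a list and accepts if some function in `S`
is consistent with all the answers that are not erased. -/
noncomputable def consistencyTest : Set (X → Y) → List X → QueryTree X Y
  | S, [] => .output (decide S.Nonempty)
  | S, x :: xs => .query x fun a => consistencyTest {g ∈ S | ∀ y, a = some y → g x = y} xs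

theorem consistencyTest_queriesAtMost (S : Set (X → Y)) (xs : List X) :
    (consistencyTest S xs).QueriesAtMost xs.length := by
  induction xs generalizing S with
  | nil => trivial
  | cons x xs ih => exact fun a => ih _

variable [DecidableEq X] {t : ℕ} (f : X → Y) (adv : ErasureAdversary X t)

/-- The function `g` is consistent with all the answers received along a list of queries. -/
def ErasureAdversary.Survives (g : X → Y) : List X → List X → Finset X → Prop
  | [], _, _ => True
  | x :: xs, history, erased => (x ∈ erased ∨ f x = g x) ∧
      Survives g xs (history ++ [x]) (erased ∪ adv.erase (history ++ [x]))

theorem consistencyTest_run_of_mem {S : Set (X → Y)} (hf : f ∈ S) (xs : List X) :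
    (consistencyTest S xs).run f adv = true := by
  unfold QueryTree.run
  generalize ([] : List X) = history
  generalize (∅ : Finset X) = erased
  induction xs generalizing S history erased with
  | nil => simpa [consistencyTest, QueryTree.runFrom] using ⟨f, hf⟩
  | cons x xs ih =>
    rw [consistencyTest, QueryTree.runFrom]
    apply ih
    refine ⟨hf, fun y hy => ?_⟩
    split_ifs at hy
    exact Option.some_injective _ hy

theorem exists_survives_of_run {S : Set (X → Y)} {xs : List X}
    (h : (consistencyTest S xs).run f adv = true) : ∃ g ∈ S, adv.Survives f g xs [] ∅ := by
  unfold QueryTree.run at h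
  revert h
  generalize ([] : List X) = history
  generalize (∅ : Finset X) = erased
  intro h
  induction xs generalizing S history erased with
  | nil =>
    simp only [consistencyTest, QueryTree.runFrom, decide_eq_true_eq] at h
    obtain ⟨g, hg⟩ := h
    exact ⟨g, hg, trivial⟩
  | cons x xs ih =>
    rw [consistencyTest, QueryTree.runFrom] at h
    obtain ⟨g, ⟨hg, hgx⟩, hs⟩ := ih _ _ h
    refine ⟨g, hg, ?_, hs⟩
    by_cases hx : x ∈ erased
    · exact Or.inl hx
    · exact Or.inr (hgx _ (by rw [if_neg hx])).symm

/-- Survival depends only on values at queried points. The union bound can therefore run over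
restrictions to a surface instead of functions on `F ^ n`. -/
theorem survives_congr {g g' : X → Y} {xs : List X} (h : ∀ x ∈ xs, g x = g' x)
    (history : List X) (erased : Finset X) (hs : adv.Survives f g xs history erased) :
    adv.Survives f g' xs history erased := by
  induction xs generalizing history erased with
  | nil => trivial
  | cons x xs ih =>
    refine ⟨?_, ih (fun y hy => h y (List.mem_cons_of_mem _ hy)) _ _ hs.2⟩
    rw [← h x List.mem_cons_self]
    exact hs.1

theorem prob_equiv {α β : Type*} [Fintype α] [Fintype β] (e : α ≃ β) (p : β → Prop) :
    prob (fun a => p (e a)) = prob p := by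
  classical
  rw [prob_eq_card_div, prob_eq_card_div p, Fintype.card_congr e]
  congr 2
  exact Finset.card_equiv e (by simp)

/-- A function that disagrees with `f` with probability `ε` at an unerased query survives `m`
independent queries with probability at most `(1 - ε) ^ m`. -/
theorem prob_survives_le {U : Type*} [Fintype U] [Nonempty U] (π : U → X) (g : X → Y) {ε : ℝ}
    (hε : ε ≤ 1) {B : ℕ}
    (hstep : ∀ E : Finset X, E.card ≤ B → prob (fun u => π u ∈ E ∨ f (π u) = g (π u)) ≤ 1 - ε)
    (m : ℕ) (history : List X) (erased : Finset X) (hB : erased.card + t * m ≤ B) :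
    prob (fun u : Fin m → U => adv.Survives f g (List.ofFn fun i => π (u i)) history erased)
      ≤ (1 - ε) ^ m := by
  classical
  induction m generalizing history erased with
  | zero =>
    rw [pow_zero, prob]
    exact div_le_one_of_le₀ (by exact_mod_cast Finset.card_le_univ _) (by positivity)
  | succ m ih =>
    have hU : (0 : ℝ) < Fintype.card U := by exact_mod_cast Fintype.card_pos
    -- Split off the first query. Once it is fixed, the remaining points are still independent and
    -- uniform, and at most `t` entries have been added to the erased set.
    rw [← prob_equiv ((Equiv.prodComm _ _).trans (Fin.consEquiv fun _ : Fin (m + 1) => U)),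
      prob_prod, div_le_iff₀ hU]
    have hterm (u₀ : U) : prob (fun u : Fin m → U => adv.Survives f g (List.ofFn fun i =>
        π ((Fin.cons u₀ u : Fin (m + 1) → U) i)) history erased)
        ≤ (if π u₀ ∈ erased ∨ f (π u₀) = g (π u₀) then (1 : ℝ) else 0) * (1 - ε) ^ m := by
      simp only [List.ofFn_succ, Fin.cons_zero, Fin.cons_succ, ErasureAdversary.Survives]
      split_ifs with h
      · rw [one_mul]
        refine (prob_mono fun u hu => hu.2).trans (ih _ _ ?_)
        have h1 := Finset.card_union_le erased (adv.erase (history ++ [π u₀]))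
        have h2 := adv.card_le (history ++ [π u₀])
        rw [mul_add, mul_one] at hB
        omega
      · simp [h, prob]
    refine (Finset.sum_le_sum fun u₀ _ => hterm u₀).trans ?_
    rw [← Finset.sum_mul, sum_indicator_eq_card_mul_prob]
    have h1 := hstep erased (by omega)
    have h2 : 0 ≤ (1 - ε) ^ m := pow_nonneg (by linarith) _
    rw [pow_succ]
    calc Fintype.card U * prob (fun u => π u ∈ erased ∨ f (π u) = g (π u)) * (1 - ε) ^ m
        ≤ Fintype.card U * (1 - ε) * (1 - ε) ^ m := by gcongr
      _ = _ := by ring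

end ConsistencyTest

/-! ### The randomized test and the union bound -/

section RandomizedConsistencyTest

variable {X Y : Type*} [DecidableEq X] {t : ℕ}

/-- Choose `ψ` and `m` independent points `u` uniformly at random, and run the consistency test on
the points `π ψ u`. -/
noncomputable def randomizedConsistencyTest {Ψ U : Type*} [Fintype Ψ] [Nonempty Ψ] [Fintype U]
    [Nonempty U] (S : Set (X → Y)) (π : Ψ → U → X) (m : ℕ) : RandomizedAlgorithm X Y :=
  (PMF.uniformOfFintype ((Fin m → U) × Ψ)).map fun ω =>
    consistencyTest S (List.ofFn fun i => π ω.2 (ω.1 i))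

theorem map_uniformOfFintype_apply {α β : Type*} [Fintype α] [Nonempty α] (g : α → β) (b : β) :
    (PMF.uniformOfFintype α).map g b = ENNReal.ofReal (prob fun a => g a = b) := by
  classical
  have h0 : (0 : ℝ) < Fintype.card α := by exact_mod_cast Fintype.card_pos
  rw [PMF.map_apply, tsum_fintype, prob_eq_card_div, ENNReal.ofReal_div_of_pos h0,
    ENNReal.ofReal_natCast, ENNReal.ofReal_natCast]
  simp only [PMF.uniformOfFintype_apply, eq_comm (a := b)]
  rw [← Finset.sum_filter, Finset.sum_const, nsmul_eq_mul, ENNReal.div_eq_inv_mul, mul_comm]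

variable {Ψ U : Type*} [Fintype Ψ] [Nonempty Ψ] [Fintype U] [Nonempty U] {S : Set (X → Y)}
  {π : Ψ → U → X} {m : ℕ}

omit [DecidableEq X] in
theorem randomizedConsistencyTest_queriesAtMost :
    (randomizedConsistencyTest S π m).QueriesAtMost m := by
  intro T hT
  rw [randomizedConsistencyTest, PMF.mem_support_map_iff] at hT
  obtain ⟨ω, -, rfl⟩ := hT
  simpa using consistencyTest_queriesAtMost S (List.ofFn fun i => π ω.2 (ω.1 i))

theorem randomizedConsistencyTest_outputDist (f : X → Y) (adv : ErasureAdversary X t) (b : Bool) :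
    (randomizedConsistencyTest S π m).outputDist f adv b = ENNReal.ofReal
      (prob fun ω : (Fin m → U) × Ψ =>
        (consistencyTest S (List.ofFn fun i => π ω.2 (ω.1 i))).run f adv = b) := by
  rw [RandomizedAlgorithm.outputDist, randomizedConsistencyTest, PMF.map_comp,
    map_uniformOfFintype_apply]
  rfl

theorem randomizedConsistencyTest_accepts {f : X → Y} (hf : f ∈ S) (adv : ErasureAdversary X t) :
    (randomizedConsistencyTest S π m).outputDist f adv true = 1 := by
  classical
  rw [randomizedConsistencyTest_outputDist]
  simp only [consistencyTest_run_of_mem f adv hf]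
  rw [prob_eq_card_div, Finset.filter_true, Finset.card_univ, div_self]
  · simp
  · exact_mod_cast Fintype.card_ne_zero

theorem prob_prod_le_of_section {α β : Type*} [Fintype α] [Fintype β] [Nonempty β] {c : ℝ}
    [Nonempty α] (p : α × β → Prop) (good : β → Prop) (hc : 0 ≤ c)
    (h : ∀ b, good b → prob (fun a => p (a, b)) ≤ c) :
    prob p ≤ prob (fun b => ¬ good b) + c := by
  classical
  have h0 : (0 : ℝ) < Fintype.card β := by exact_mod_cast Fintype.card_pos
  rw [prob_prod, div_le_iff₀ h0]
  calc ∑ b, prob (fun a => p (a, b)) ≤ ∑ b, ((if ¬ good b then 1 else 0) + c) := by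
        refine Finset.sum_le_sum fun b _ => ?_
        by_cases hb : good b
        · simpa [hb] using h b hb
        · have h1 := prob_not fun a => ¬ p (a, b)
          have h2 := prob_nonneg fun a => ¬ p (a, b)
          simp only [not_not] at h1
          simp only [hb, not_false_eq_true, if_true]
          linarith
    _ = _ := by
        rw [Finset.sum_add_distrib, sum_indicator_eq_card_mul_prob, Finset.sum_const,
          Finset.card_univ, nsmul_eq_mul]
        ring

/-- Soundness of the randomized consistency test: the union bound over the restrictions of the
functions in `S` to the image of `π ψ`. -/
theorem randomizedConsistencyTest_rejects [Finite Y] (f : X → Y) (adv : ErasureAdversary X t)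
    (good : Ψ → Prop) {N ε κ : ℝ} (hε : ε ≤ 1) (hN : 0 ≤ N)
    (hbad : prob (fun ψ => ¬ good ψ) ≤ κ)
    (hcard : ∀ ψ, ((fun g : X → Y => fun u => g (π ψ u)) '' S).ncard ≤ N)
    (hstep : ∀ ψ, good ψ → ∀ g ∈ S, ∀ E : Finset X, E.card ≤ t * m →
      prob (fun u => π ψ u ∈ E ∨ f (π ψ u) = g (π ψ u)) ≤ 1 - ε)
    (hlast : κ + N * (1 - ε) ^ m ≤ 1 / 3) :
    2 / 3 ≤ (randomizedConsistencyTest S π m).outputDist f adv false := by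
  classical
  have hpow : 0 ≤ (1 - ε) ^ m := pow_nonneg (by linarith) _
  have haccept : prob (fun ω : (Fin m → U) × Ψ =>
      (consistencyTest S (List.ofFn fun i => π ω.2 (ω.1 i))).run f adv = true) ≤ 1 / 3 := by
    refine (prob_prod_le_of_section (c := N * (1 - ε) ^ m) _ good (by positivity)
      fun ψ hψ => ?_).trans (by linarith)
    let 𝒢 := (fun g : X → Y => fun u => g (π ψ u)) '' S
    have hfin : 𝒢.Finite := Set.toFinite _
    have hrep : ∀ h ∈ 𝒢, ∃ g ∈ S, (fun u => g (π ψ u)) = h := fun h hh => hh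
    have : Nonempty (X → Y) := ⟨f⟩
    -- One representative in `S` per restriction, chosen before the points `u` are drawn, so the
    -- survival bound applies to each.
    choose! rep hrepS hrep_eq using hrep
    have hsurv : ∀ u : Fin m → U,
        (consistencyTest S (List.ofFn fun i => π ψ (u i))).run f adv = true →
        ∃ h ∈ hfin.toFinset, adv.Survives f (rep h) (List.ofFn fun i => π ψ (u i)) [] ∅ := by
      intro u hu
      obtain ⟨g, hg, hs⟩ := exists_survives_of_run f adv hu
      have hmem : (fun u => g (π ψ u)) ∈ 𝒢 := ⟨g, hg, rfl⟩
      refine ⟨fun u => g (π ψ u), hfin.mem_toFinset.2 hmem, ?_⟩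
      refine survives_congr f adv (fun x hx => ?_) _ _ hs
      obtain ⟨i, rfl⟩ := (List.mem_ofFn' _ _).1 hx
      exact (congrFun (hrep_eq _ hmem) (u i)).symm
    refine (prob_mono hsurv).trans ((prob_exists_mem_le _ _).trans ?_)
    calc _ ≤ ∑ h ∈ hfin.toFinset, (1 - ε) ^ m := by
          refine Finset.sum_le_sum fun h hh => ?_
          exact prob_survives_le f adv (π ψ) (rep h) hε
            (hstep ψ hψ _ (hrepS h (hfin.mem_toFinset.1 hh))) m [] ∅ (by simp)
      _ = (𝒢.ncard : ℝ) * (1 - ε) ^ m := by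
          rw [Finset.sum_const, nsmul_eq_mul, Set.ncard_eq_toFinset_card _ hfin]
      _ ≤ _ := mul_le_mul_of_nonneg_right (hcard ψ) hpow
  rw [randomizedConsistencyTest_outputDist]
  have hnot := prob_not fun ω : (Fin m → U) × Ψ =>
      (consistencyTest S (List.ofFn fun i => π ω.2 (ω.1 i))).run f adv = true
  simp only [Bool.not_eq_true] at hnot
  rw [hnot, show (2 / 3 : ℝ≥0∞) = ENNReal.ofReal (2 / 3) by
    rw [ENNReal.ofReal_div_of_pos (by norm_num)]; norm_num]
  exact ENNReal.ofReal_le_ofReal (by linarith)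

end RandomizedConsistencyTest

/-! ### Counting monomials and restrictions to surfaces -/

section Counting

open MvPolynomial

/-- The exponents of the monomials of degree at most `D`. -/
noncomputable def exponentsOfDegreeLE (σ : Type*) [Finite σ] (D : ℕ) : Finset (σ →₀ ℕ) :=
  (Finsupp.finite_of_degree_le D).toFinset

/-- Rankin's trick: give an exponent `m` the weight `x ^ m.degree ≥ x ^ D`; the total weight factors
into geometric series. -/
theorem card_exponentsOfDegreeLE_mul_pow_le (σ : Type*) [Fintype σ] (D : ℕ) {x : ℝ} (hx0 : 0 < x)
    (hx1 : x < 1) :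
    ((exponentsOfDegreeLE σ D).card : ℝ) * x ^ D ≤ ((1 - x)⁻¹) ^ Fintype.card σ := by
  classical
  have hinj : Set.InjOn (fun m : σ →₀ ℕ => (m : σ → ℕ)) (exponentsOfDegreeLE σ D) :=
    DFunLike.coe_injective.injOn
  have hsub : (exponentsOfDegreeLE σ D).image (fun m : σ →₀ ℕ => (m : σ → ℕ))
      ⊆ Fintype.piFinset fun _ => Finset.range (D + 1) := by
    intro a ha
    obtain ⟨m, hm, rfl⟩ := Finset.mem_image.1 ha
    have hm' : m.degree ≤ D := by simpa [exponentsOfDegreeLE] using hm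
    refine Fintype.mem_piFinset.2 fun i => Finset.mem_range.2 ?_
    have := Finsupp.le_degree i m
    omega
  calc ((exponentsOfDegreeLE σ D).card : ℝ) * x ^ D
      = ∑ m ∈ exponentsOfDegreeLE σ D, x ^ D := by rw [Finset.sum_const, nsmul_eq_mul]
    _ ≤ ∑ m ∈ exponentsOfDegreeLE σ D, ∏ i, x ^ m i := by
        refine Finset.sum_le_sum fun m hm => ?_
        have hm' : m.degree ≤ D := by simpa [exponentsOfDegreeLE] using hm
        rw [Finset.prod_pow_eq_pow_sum, ← Finsupp.degree_eq_sum]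
        exact pow_le_pow_of_le_one hx0.le hx1.le hm'
    _ = ∑ a ∈ (exponentsOfDegreeLE σ D).image (fun m : σ →₀ ℕ => (m : σ → ℕ)),
        ∏ i, x ^ a i := (Finset.sum_image (f := fun a : σ → ℕ => ∏ i, x ^ a i) hinj).symm
    _ ≤ ∑ a ∈ Fintype.piFinset fun _ : σ => Finset.range (D + 1), ∏ i, x ^ a i :=
        Finset.sum_le_sum_of_subset_of_nonneg hsub fun _ _ _ => by positivity
    _ = ∏ _i : σ, ∑ j ∈ Finset.range (D + 1), x ^ j :=
        (Finset.prod_univ_sum (fun _ : σ => Finset.range (D + 1)) fun _ j => x ^ j).symm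
    _ = (∑ j ∈ Finset.range (D + 1), x ^ j) ^ Fintype.card σ := by
        rw [Finset.prod_const, Finset.card_univ]
    _ ≤ _ := by
        refine pow_le_pow_left₀ (Finset.sum_nonneg fun _ _ => by positivity) ?_ _
        rw [← tsum_geometric_of_lt_one hx0.le hx1]
        exact (summable_geometric_of_lt_one hx0.le hx1).sum_le_tsum _ fun _ _ => by positivity

theorem exponentsOfDegreeLE_card_pos (σ : Type*) [Finite σ] (D : ℕ) :
    0 < (exponentsOfDegreeLE σ D).card :=
  Finset.card_pos.2 ⟨0, by simp [exponentsOfDegreeLE]⟩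

variable {F : Type*} [Field F] [Fintype F]

/-- The number of functions given by polynomials of degree at most `D` on a set of points. -/
theorem ncard_eval_le {σ U : Type*} [Fintype σ] (D : ℕ) (e : U → σ → F) (𝒢 : Set (U → F))
    (h : ∀ φ ∈ 𝒢, ∃ Q : MvPolynomial σ F, Q.totalDegree ≤ D ∧ ∀ u, eval (e u) Q = φ u) :
    𝒢.ncard ≤ Fintype.card F ^ (exponentsOfDegreeLE σ D).card := by
  classical
  let ev (c : exponentsOfDegreeLE σ D → F) (u : U) : F :=
    ∑ m, c m * ∏ i, e u i ^ (m : σ →₀ ℕ) i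
  have hsub : 𝒢 ⊆ Set.range ev := by
    intro φ hφ
    obtain ⟨Q, hQ, hQe⟩ := h φ hφ
    refine ⟨fun m => coeff m Q, funext fun u => ?_⟩
    rw [← hQe, eval_eq']
    simp only [ev]
    rw [Finset.sum_coe_sort (exponentsOfDegreeLE σ D)
      fun m => coeff m Q * ∏ i, e u i ^ (m : σ →₀ ℕ) i]
    symm
    apply Finset.sum_subset
    · intro m hm
      exact (Set.Finite.mem_toFinset _).2 ((le_totalDegree hm).trans hQ)
    · intro m _ hm
      rw [notMem_support_iff.1 hm, zero_mul]
  refine (Set.ncard_le_ncard hsub (Set.finite_range _)).trans ?_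
  rw [← Set.image_univ]
  refine (Set.ncard_image_le Set.finite_univ).trans ?_
  simp [Set.ncard_univ, Nat.card_eq_fintype_card]

/-- Surface points are affine in `y` and in `v` separately, so substituting them at most doubles the
degree. The count involves `r` but not `n`. -/
theorem ncard_surface_restrictions_le {n d r : ℕ} (ψ : SurfaceParam F n d r) :
    ((fun g : (Fin n → F) → F => fun u => g (surfacePoint ψ u)) '' reedMuller F n d).ncard
      ≤ Fintype.card F ^ (exponentsOfDegreeLE (Fin (d + 1) ⊕ Fin r) (d * 2)).card := by
  refine ncard_eval_le _
    (fun u : (Fin (d + 1) → F) × (Fin r → F) => Sum.elim u.1 u.2) _ ?_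
  rintro _ ⟨g, ⟨P, -, hPd, hPg⟩, rfl⟩
  let lin (b : F) (M : Fin r → F) : MvPolynomial (Fin (d + 1) ⊕ Fin r) F :=
    C b + ∑ j, X (Sum.inr j) * C (M j)
  have hlin (b M) : (lin b M).totalDegree ≤ 1 := by
    refine (totalDegree_add _ _).trans (max_le (by simp) ?_)
    refine totalDegree_finsetSum_le fun i _ => (totalDegree_mul _ _).trans ?_
    simp
  let Q (i : Fin n) : MvPolynomial (Fin (d + 1) ⊕ Fin r) F :=
    lin (ψ.1.1 i) (fun j => (ψ.2 j).1 i)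
      + ∑ l, X (Sum.inl l) * lin (ψ.1.2 l i) (fun j => (ψ.2 j).2 l i)
  have hQ (i) : (Q i).totalDegree ≤ 2 := by
    refine (totalDegree_add _ _).trans (max_le ((hlin _ _).trans (by norm_num)) ?_)
    refine totalDegree_finsetSum_le fun l _ => (totalDegree_mul _ _).trans ?_
    rw [totalDegree_X]
    have := hlin (ψ.1.2 l i) (fun j => (ψ.2 j).2 l i)
    omega
  refine ⟨bind₁ Q P, totalDegree_bind₁_le P Q hPd hQ, fun u => ?_⟩
  refine (eval_bind₁ _ _ _).trans (Eq.trans ?_ (hPg _))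
  congr 2
  funext i
  simp [Q, lin, surfacePoint, affineMapOf, Finset.sum_apply, Prod.fst_sum, Prod.snd_sum, mul_add]

end Counting

/-! ### Conditions on the parameters and their choice -/

section Parameters

/-- `h1` and `h2` make Chebyshev and the coincidences fail with probability at most `1 / 10` each,
`h3` bounds the erased fraction by `ε`, and `h4` bounds the union over restrictions by `1 / 10`. The
sum is below `1 / 3`. -/
theorem randomizedConsistencyTest_isTester {F : Type*} [Field F] [Fintype F] [DecidableEq F]
    {n t d r m N : ℕ} {δ K : ℝ} (hδ : 0 < δ) (hδ1 : δ ≤ 1)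
    (hK : K = (Fintype.card F : ℝ) ^ (d + 1))
    (hN : N = (exponentsOfDegreeLE (Fin (d + 1) ⊕ Fin r) (d * 2)).card)
    (h1 : 120 * K ^ 2 ≤ δ * (Fintype.card F : ℝ) ^ r)
    (h2 : 10 * (Fintype.card F : ℝ) ^ (d + 1 + 2 * r) ≤ (Fintype.card F : ℝ) ^ n)
    (h3 : 12 * K ^ 3 * (t * m) ≤ δ * (Fintype.card F : ℝ) ^ r)
    (h4 : (Fintype.card F : ℝ) ^ N * Real.exp (-(δ / (12 * K ^ 3) * m)) ≤ 1 / 10) :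
    IsErasureResilientDegreeTester t d δ (randomizedConsistencyTest (reedMuller F n d)
      (surfacePoint (F := F) (n := n) (d := d) (r := r)) m) := by
  have hq : (2 : ℝ) ≤ Fintype.card F := by exact_mod_cast Fintype.one_lt_card (α := F)
  have hq0 : (0 : ℝ) < Fintype.card F := by linarith
  have hK1 : 1 ≤ K := by rw [hK]; exact one_le_pow₀ (by linarith)
  have hK0 : 0 < K := by linarith
  have hr0 : 0 < (Fintype.card F : ℝ) ^ r := by positivity
  refine ⟨fun f hf adv => randomizedConsistencyTest_accepts hf adv, fun f hf adv => ?_⟩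
  have hρ := rejProb_ge_of_isFarFromDegree f hδ1 hf
  rw [← hK] at hρ
  have hρ0 : 0 < rejProb d f := lt_of_lt_of_le (by positivity) hρ
  have hε : δ / (12 * K ^ 3) ≤ 1 := by
    rw [div_le_one (by positivity)]
    have : 1 ≤ K ^ 3 := one_le_pow₀ hK1
    linarith
  refine randomizedConsistencyTest_rejects f adv (IsGoodSurface f) hε
    (N := (Fintype.card F : ℝ) ^ N) (κ := 1 / 5) (by positivity) ?_ (fun ψ => ?_) ?_ ?_
  · refine (prob_not_isGoodSurface_le f hρ0).trans ?_
    have e1 : 4 / ((Fintype.card F : ℝ) ^ r * rejProb d f) ≤ 1 / 10 := by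
      rw [div_le_iff₀ (by positivity)] at hρ
      rw [div_le_div_iff₀ (by positivity) (by norm_num)]
      have h5 : 120 * K ^ 2 ≤ rejProb d f * (3 * K ^ 2) * (Fintype.card F : ℝ) ^ r :=
        h1.trans (mul_le_mul_of_nonneg_right hρ hr0.le)
      have h6 : 3 * K ^ 2 * 40 ≤ 3 * K ^ 2 * ((Fintype.card F : ℝ) ^ r * rejProb d f) := by
        linarith
      have := le_of_mul_le_mul_left h6 (by positivity)
      linarith
    have e2 : (Fintype.card F : ℝ) ^ (d + 1 + 2 * r) / (Fintype.card F : ℝ) ^ n ≤ 1 / 10 := by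
      rw [div_le_div_iff₀ (by positivity) (by norm_num)]
      linarith
    linarith
  · rw [hN]
    exact_mod_cast ncard_surface_restrictions_le ψ
  · intro ψ hψ g hg E hE
    refine (prob_or_le _ _).trans ?_
    have e1 := prob_surface_mem_le hψ E
    have e2 := prob_surface_ne_ge hψ hg
    have e3 := prob_not fun u => f (surfacePoint ψ u) ≠ g (surfacePoint ψ u)
    simp only [ne_eq, not_not] at e3
    rw [← hK] at e2
    have e4 : (E.card : ℝ) / (Fintype.card F : ℝ) ^ r ≤ δ / (12 * K ^ 3) := by
      rw [div_le_div_iff₀ hr0 (by positivity)]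
      have : (E.card : ℝ) ≤ t * m := by exact_mod_cast hE
      have h12 : (0 : ℝ) ≤ 12 * K ^ 3 := by positivity
      nlinarith
    -- The disagreement is at least `δ / (6 K ^ 3) = 2 ε`; erasures take away at most one `ε`.
    have e5 : 2 * (δ / (12 * K ^ 3)) ≤ rejProb d f / (2 * K) := by
      rw [le_div_iff₀ (by positivity)]
      refine le_trans (le_of_eq ?_) hρ
      field_simp
      norm_num
    simp only [ne_eq] at e2
    linarith
  · have h5 : (1 - δ / (12 * K ^ 3)) ^ m ≤ Real.exp (-(δ / (12 * K ^ 3) * m)) := by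
      calc (1 - δ / (12 * K ^ 3)) ^ m ≤ Real.exp (-(δ / (12 * K ^ 3))) ^ m :=
            pow_le_pow_left₀ (by linarith) (Real.one_sub_le_exp_neg _) _
        _ = _ := by rw [← Real.exp_nat_mul]; congr 1; ring
    have h6 : (Fintype.card F : ℝ) ^ N * (1 - δ / (12 * K ^ 3)) ^ m ≤ 1 / 10 :=
      (mul_le_mul_of_nonneg_left h5 (by positivity)).trans h4
    linarith

/-- Taking `x = 1 / (k + 1)` leaves `(1 + 1 / k) ^ k ≤ 3`. This bound, polynomial in `k`, yields the
query complexity. -/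
theorem card_exponentsOfDegreeLE_le_pow_card (σ : Type*) [Fintype σ] (D : ℕ)
    (hσ : 0 < Fintype.card σ) :
    ((exponentsOfDegreeLE σ D).card : ℝ) ≤ 3 * ((Fintype.card σ : ℝ) + 1) ^ D := by
  set k : ℝ := (Fintype.card σ : ℝ) with hk
  have hk0 : 0 < k := by rw [hk]; exact_mod_cast hσ
  have h := card_exponentsOfDegreeLE_mul_pow_le σ D (x := 1 / (k + 1)) (by positivity)
    (by rw [div_lt_one (by positivity)]; linarith)
  have e1 : (1 - 1 / (k + 1))⁻¹ = 1 + 1 / k := by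
    have : 1 - 1 / (k + 1) = k / (k + 1) := by field_simp; ring
    rw [this, inv_div, add_div, div_self hk0.ne']
  have e2 : (1 + 1 / k) ^ Fintype.card σ ≤ 3 := by
    have h1 : 1 + 1 / k ≤ Real.exp (1 / k) := by linarith [Real.add_one_le_exp (1 / k)]
    calc (1 + 1 / k) ^ Fintype.card σ ≤ Real.exp (1 / k) ^ Fintype.card σ :=
          pow_le_pow_left₀ (by positivity) h1 _
      _ = Real.exp 1 := by
          rw [← Real.exp_nat_mul, ← hk, mul_one_div_cancel hk0.ne']
      _ ≤ 3 := by linarith [Real.exp_one_lt_d9]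
  rw [e1, one_div_pow, mul_one_div, div_le_iff₀ (by positivity)] at h
  exact h.trans (mul_le_mul_of_nonneg_right e2 (by positivity))

/-- The choice of `r` is circular, since `N` depends on `r`. With `x = 1 / 4` and `(4 / 3) ^ 2 ≤ 2`,
`N` grows only like `2 ^ (r / 2)`, which `q ^ r` can absorb. -/
theorem card_exponentsOfDegreeLE_le_two_pow (a d : ℕ) :
    ((exponentsOfDegreeLE (Fin (d + 1) ⊕ Fin (4 * a + 21 * d + 15)) (d * 2)).card : ℝ)
      ≤ 2 ^ (2 * a + 15 * d + 8) := by
  have h := card_exponentsOfDegreeLE_mul_pow_le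
    (Fin (d + 1) ⊕ Fin (4 * a + 21 * d + 15)) (d * 2) (x := 1 / 4) (by norm_num) (by norm_num)
  rw [one_div_pow, mul_one_div, div_le_iff₀ (by positivity)] at h
  refine h.trans ?_
  simp only [Fintype.card_sum, Fintype.card_fin]
  rw [show (1 - 1 / 4 : ℝ)⁻¹ = 4 / 3 by norm_num,
    show d + 1 + (4 * a + 21 * d + 15) = 2 * (2 * a + 11 * d + 8) by ring, pow_mul,
    show d * 2 = 2 * d by ring, pow_mul (4 : ℝ)]
  calc ((4 / 3 : ℝ) ^ 2) ^ (2 * a + 11 * d + 8) * (4 ^ 2) ^ d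
      ≤ 2 ^ (2 * a + 11 * d + 8) * (2 ^ 4) ^ d := by
        gcongr <;> norm_num
    _ = 2 ^ (2 * a + 15 * d + 8) := by rw [← pow_mul, ← pow_add]; congr 1; ring

/-- The least `a` with `100 t / δ ≤ q ^ a` is logarithmic in `t / δ` and much smaller than `n`. -/
theorem exists_logarithmic_exponent {q n t d : ℕ} {δ : ℝ} (hq : 2 ≤ q) (hδ : 0 < δ) (hδ1 : δ ≤ 1)
    (ht : 1 ≤ t)
    (h : (t : ℝ) ≤ δ / 100 * (q : ℝ) ^ ((n : ℝ) / (100 * ((d : ℝ) + (q : ℝ))) - 1)) :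
    ∃ a : ℕ, 100 * t / δ ≤ (q : ℝ) ^ a ∧ 8 * a + 43 * d + 35 ≤ n ∧
      (a : ℝ) ≤ 2 * Real.log (t / δ) + 11 := by
  have hqR : (2 : ℝ) ≤ q := by exact_mod_cast hq
  have htR : (1 : ℝ) ≤ t := by exact_mod_cast ht
  have hlogq : 0 < Real.log q := Real.log_pos (by linarith)
  have hlogq2 : 1 / 2 ≤ Real.log q :=
    le_trans (by linarith [Real.log_two_gt_d9]) (Real.log_le_log (by norm_num) hqR)
  have htδ : 1 ≤ t / δ := by rw [le_div_iff₀ hδ]; linarith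
  set τ : ℝ := 100 * t / δ with hτ
  have hτ' : τ = 100 * (t / δ) := by rw [hτ]; ring
  have hτ1 : 1 ≤ τ := by rw [hτ']; linarith
  have hlogτ : 0 ≤ Real.log τ := Real.log_nonneg hτ1
  set l : ℝ := Real.log τ / Real.log q with hl
  have hl0 : 0 ≤ l := by positivity
  have hle : Real.log τ ≤ ((n : ℝ) / (100 * ((d : ℝ) + q)) - 1) * Real.log q := by
    rw [← Real.log_rpow (by linarith)]
    refine Real.log_le_log (by linarith) ?_
    rw [hτ, div_le_iff₀ hδ]
    linarith
  have hln : (l + 1) * (100 * ((d : ℝ) + q)) ≤ n := by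
    have h1 : l ≤ (n : ℝ) / (100 * ((d : ℝ) + q)) - 1 := by
      rw [hl, div_le_iff₀ hlogq]; exact hle
    rw [← le_div_iff₀ (by positivity)]
    linarith
  have hceil : (⌈l⌉₊ : ℝ) < l + 1 := Nat.ceil_lt_add_one hl0
  refine ⟨⌈l⌉₊, ?_, ?_, ?_⟩
  · rw [← Real.log_le_log_iff (by linarith) (by positivity), Real.log_pow, ← div_le_iff₀ hlogq]
    exact Nat.le_ceil l
  · have hd : (0 : ℝ) ≤ d := Nat.cast_nonneg _
    have h3 : (l + 1) * (100 * ((d : ℝ) + 2)) ≤ n := by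
      refine le_trans ?_ hln
      gcongr
    have : (8 * ⌈l⌉₊ + 43 * d + 35 : ℝ) ≤ n := by nlinarith
    exact_mod_cast this
  · have h5 : Real.log 100 ≤ 5 := by
      rw [Real.log_le_iff_le_exp (by norm_num)]
      have : Real.exp 5 = Real.exp 1 ^ 5 := by rw [← Real.exp_nat_mul]; norm_num
      rw [this]
      calc (100 : ℝ) ≤ 2.7 ^ 5 := by norm_num
        _ ≤ _ := pow_le_pow_left₀ (by norm_num) (by linarith [Real.exp_one_gt_d9]) _
    have h6 : Real.log τ = Real.log 100 + Real.log (t / δ) := by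
      rw [hτ', Real.log_mul (by norm_num) (by linarith)]
    have h7 : l ≤ 2 * Real.log τ := by
      rw [hl, div_le_iff₀ hlogq]; nlinarith
    linarith

theorem pow_mul_exp_neg_le {q : ℝ} (hq : 0 ≤ q) (N : ℕ) {s : ℝ} (hs : N * q + 3 ≤ s) :
    q ^ N * Real.exp (-s) ≤ 1 / 10 := by
  have h1 : q ^ N ≤ Real.exp (N * q) := by
    rw [Real.exp_nat_mul]
    exact pow_le_pow_left₀ hq (by linarith [Real.add_one_le_exp q]) _
  have h2 : Real.exp 3 = Real.exp 1 ^ 3 := by rw [← Real.exp_nat_mul]; norm_num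
  have h3 : 10 ≤ Real.exp 3 := by
    rw [h2]
    calc (10 : ℝ) ≤ 2.7 ^ 3 := by norm_num
      _ ≤ _ := pow_le_pow_left₀ (by norm_num) (by linarith [Real.exp_one_gt_d9]) _
  calc q ^ N * Real.exp (-s) ≤ Real.exp (N * q) * Real.exp (-(N * q + 3)) := by
        gcongr
    _ = (Real.exp 3)⁻¹ := by rw [← Real.exp_add, ← Real.exp_neg]; congr 1; ring
    _ ≤ 1 / 10 := by
        rw [inv_le_comm₀ (by positivity) (by norm_num)]
        linarith

/-- The number of queries of the tester. -/
noncomputable def testerQueryCount (q d N : ℕ) (δ : ℝ) : ℕ :=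
  ⌈12 * ((q : ℝ) ^ (d + 1)) ^ 3 / δ * (N * q + 3)⌉₊

theorem testerQueryCount_le {q d N : ℕ} {δ : ℝ} (hq : 2 ≤ q) (hN : 0 < N) (hδ : 0 < δ)
    (hδ1 : δ ≤ 1) :
    (testerQueryCount q d N δ : ℝ) ≤ 36 * (q : ℝ) ^ (3 * d + 4) * N / δ := by
  have hqR : (2 : ℝ) ≤ q := by exact_mod_cast hq
  have hNR : (1 : ℝ) ≤ N := by exact_mod_cast hN
  set K3 : ℝ := ((q : ℝ) ^ (d + 1)) ^ 3 with hK3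
  have hK1 : 1 ≤ K3 := one_le_pow₀ (one_le_pow₀ (by linarith))
  have hD : 1 ≤ 12 * K3 / δ := by rw [le_div_iff₀ hδ]; linarith
  have h1 := (Nat.ceil_lt_add_one (a := 12 * K3 / δ * (N * q + 3)) (by positivity)).le
  have h2 : (2 : ℝ) ≤ N * q := by nlinarith
  calc (testerQueryCount q d N δ : ℝ) ≤ 12 * K3 / δ * (N * q + 3) + 1 := h1
    _ ≤ 12 * K3 / δ * (3 * (N * q)) := by nlinarith
    _ = 36 * (q : ℝ) ^ (3 * d + 4) * N / δ := by
        rw [show 3 * d + 4 = (d + 1) * 3 + 1 by ring, pow_succ, pow_mul, ← hK3]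
        ring

end Parameters

/-! ### The main theorem -/

theorem theorem2 (d : ℕ) :
    ∃ C : ℕ, ∀ (F : Type*) [Field F] [Fintype F] [DecidableEq F] (n t : ℕ) (δ : ℝ),
      0 < δ → δ ≤ 1 → 1 ≤ t →
      (t : ℝ) ≤ δ / 100 *
        (Fintype.card F : ℝ) ^ ((n : ℝ) / (100 * ((d : ℝ) + (Fintype.card F : ℝ))) - 1) →
      ∃ (A : RandomizedAlgorithm (Fin n → F) F) (m : ℕ),
        A.QueriesAtMost m ∧
        (m : ℝ) ≤ (C : ℝ) * (Fintype.card F : ℝ) ^ C / δ *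
          (max (C : ℝ) (Real.log ((t : ℝ) / δ))) ^ (3 * d + 3 * Fintype.card F) ∧
        IsErasureResilientDegreeTester t d δ A := by
  -- `108 * 81 ^ d = 36 * 3 * 9 ^ (2 d)` is the leading constant. The rest absorbs `4 * 11 + 22 d +
  -- 17`, so that `4 a + 22 d + 17 ≤ 9 L`.
  refine ⟨108 * 81 ^ d + 22 * d + 61, fun F _ _ _ n t δ hδ hδ1 ht hbound => ?_⟩
  have hq : 2 ≤ Fintype.card F := Fintype.one_lt_card
  obtain ⟨a, haτ, han, halog⟩ := exists_logarithmic_exponent hq hδ hδ1 ht hbound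
  set q := Fintype.card F with hqdef
  have hqR : (2 : ℝ) ≤ q := by exact_mod_cast hq
  have htR : (1 : ℝ) ≤ t := by exact_mod_cast ht
  -- The sum of the exponents in `h3`: `3 d + 3` from `K ^ 3`, `3 d + 4` from `m`, `2 a + 15 d + 8`
  -- from `N`, and `2 a` from `t / δ ^ 2 ≤ (t / δ) ^ 2`.
  set r := 4 * a + 21 * d + 15 with hr
  set N := (exponentsOfDegreeLE (Fin (d + 1) ⊕ Fin r) (d * 2)).card with hNdef
  have hNpos : 0 < N := exponentsOfDegreeLE_card_pos _ _
  have hN2 : (N : ℝ) ≤ (q : ℝ) ^ (2 * a + 15 * d + 8) :=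
    (card_exponentsOfDegreeLE_le_two_pow a d).trans (pow_le_pow_left₀ (by norm_num) hqR _)
  have hNk : (N : ℝ) ≤ 3 * ((4 * a + 22 * d + 17 : ℕ) : ℝ) ^ (d * 2) := by
    have := card_exponentsOfDegreeLE_le_pow_card (Fin (d + 1) ⊕ Fin r) (d * 2)
      (by simp)
    refine this.trans (le_of_eq ?_)
    simp only [Fintype.card_sum, Fintype.card_fin, hr]
    push_cast
    ring
  set m := testerQueryCount q d N δ with hm
  have hmle : (m : ℝ) ≤ 36 * (q : ℝ) ^ (3 * d + 4) * N / δ := testerQueryCount_le hq hNpos hδ hδ1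
  have hmge : 12 * ((q : ℝ) ^ (d + 1)) ^ 3 / δ * (N * q + 3) ≤ m := Nat.le_ceil _
  have hK1 : 1 ≤ (q : ℝ) ^ (d + 1) := one_le_pow₀ (by linarith)
  have h3 : 12 * ((q : ℝ) ^ (d + 1)) ^ 3 * (t * m) ≤ δ * (q : ℝ) ^ r := by
    have hτ2 : t / δ ^ 2 ≤ (1 / 10000) * (q : ℝ) ^ (2 * a) := by
      have h1 : t / δ ^ 2 ≤ (1 / 10000) * (100 * t / δ) ^ 2 := by
        rw [div_pow, mul_pow, ← mul_div_assoc]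
        gcongr
        nlinarith
      refine h1.trans ?_
      rw [mul_comm 2 a, pow_mul]
      gcongr
    have hmain : ((q : ℝ) ^ (d + 1)) ^ 3 * (q : ℝ) ^ (3 * d + 4) * N * (q : ℝ) ^ (2 * a)
        ≤ (q : ℝ) ^ r := by
      calc _ ≤ ((q : ℝ) ^ (d + 1)) ^ 3 * (q : ℝ) ^ (3 * d + 4) * (q : ℝ) ^ (2 * a + 15 * d + 8)
            * (q : ℝ) ^ (2 * a) := by gcongr
        _ = (q : ℝ) ^ r := by
            rw [← pow_mul, ← pow_add, ← pow_add, ← pow_add, hr]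
            congr 1
            ring
    calc 12 * ((q : ℝ) ^ (d + 1)) ^ 3 * (t * m)
        ≤ 12 * ((q : ℝ) ^ (d + 1)) ^ 3 * (t * (36 * (q : ℝ) ^ (3 * d + 4) * N / δ)) := by gcongr
      _ = δ * (432 * (((q : ℝ) ^ (d + 1)) ^ 3 * (q : ℝ) ^ (3 * d + 4) * N) * (t / δ ^ 2)) := by
          field_simp
          norm_num
      _ ≤ δ * (432 * (((q : ℝ) ^ (d + 1)) ^ 3 * (q : ℝ) ^ (3 * d + 4) * N)
            * ((1 / 10000) * (q : ℝ) ^ (2 * a))) := by gcongr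
      _ = δ * (432 / 10000 * (((q : ℝ) ^ (d + 1)) ^ 3 * (q : ℝ) ^ (3 * d + 4) * N
            * (q : ℝ) ^ (2 * a))) := by ring
      _ ≤ δ * (432 / 10000 * (q : ℝ) ^ r) := by gcongr
      _ ≤ δ * (q : ℝ) ^ r := by
          have : 0 ≤ (q : ℝ) ^ r := by positivity
          gcongr
          linarith
  refine ⟨randomizedConsistencyTest (reedMuller F n d) (surfacePoint (r := r)) m, m,
    randomizedConsistencyTest_queriesAtMost, ?_,
    randomizedConsistencyTest_isTester hδ hδ1 rfl hNdef ?_ ?_ h3 ?_⟩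
  · set C : ℕ := 108 * 81 ^ d + 22 * d + 61 with hC
    set L : ℝ := max (C : ℝ) (Real.log (t / δ)) with hL
    have hCL : (C : ℝ) ≤ L := le_max_left _ _
    have hCd : (22 * d + 61 : ℝ) ≤ C := by
      rw [hC]; push_cast; have : (0 : ℝ) ≤ 108 * 81 ^ d := by positivity
      linarith
    have hC81 : (108 * 81 ^ d : ℝ) ≤ C := by
      rw [hC]; push_cast; have : (0 : ℝ) ≤ d := Nat.cast_nonneg _
      linarith
    have hdnn : (0 : ℝ) ≤ d := Nat.cast_nonneg _
    have hL1 : 1 ≤ L := by linarith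
    have hk : ((4 * a + 22 * d + 17 : ℕ) : ℝ) ≤ 9 * L := by
      have := le_max_right (C : ℝ) (Real.log (t / δ))
      rw [← hL] at this
      push_cast
      linarith
    have hNL : (N : ℝ) ≤ 3 * 81 ^ d * L ^ (3 * d + 3 * q) := by
      calc (N : ℝ) ≤ 3 * (9 * L) ^ (d * 2) := hNk.trans (by gcongr)
        _ = 3 * 81 ^ d * L ^ (d * 2) := by
            rw [mul_pow, mul_comm d 2, pow_mul 9 2 d]; norm_num; ring
        -- The argument gives exponent `2 d`; `L ≥ 1` allows the larger one.
        _ ≤ 3 * 81 ^ d * L ^ (3 * d + 3 * q) := by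
            gcongr
            omega
    have hqC : (q : ℝ) ^ (3 * d + 4) ≤ (q : ℝ) ^ C :=
      pow_le_pow_right₀ (by linarith) (by omega)
    calc (m : ℝ) ≤ 36 * (q : ℝ) ^ (3 * d + 4) * N / δ := hmle
      _ ≤ 36 * (q : ℝ) ^ C * (3 * 81 ^ d * L ^ (3 * d + 3 * q)) / δ := by gcongr
      _ = (108 * 81 ^ d) * (q : ℝ) ^ C / δ * L ^ (3 * d + 3 * q) := by ring
      _ ≤ C * (q : ℝ) ^ C / δ * L ^ (3 * d + 3 * q) := by gcongr
  -- The Chebyshev condition follows from the erasure condition, as `t * m ≥ 12`.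
  · refine le_trans ?_ h3
    have h12 : (12 : ℝ) ≤ m := by
      refine le_trans ?_ hmge
      have e1 : 12 ≤ 12 * ((q : ℝ) ^ (d + 1)) ^ 3 / δ := by
        rw [le_div_iff₀ hδ]
        have : 1 ≤ ((q : ℝ) ^ (d + 1)) ^ 3 := one_le_pow₀ hK1
        linarith
      have e2 : (1 : ℝ) ≤ N * q + 3 := by
        have : (0 : ℝ) ≤ N * q := by positivity
        linarith
      nlinarith
    have h13 : (12 : ℝ) ≤ t * m := by nlinarith
    have h14 : ((q : ℝ) ^ (d + 1)) ^ 2 ≤ ((q : ℝ) ^ (d + 1)) ^ 3 :=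
      pow_le_pow_right₀ hK1 (by norm_num)
    have h15 : 0 ≤ ((q : ℝ) ^ (d + 1)) ^ 3 := by positivity
    nlinarith
  · calc (10 : ℝ) * (q : ℝ) ^ (d + 1 + 2 * r) ≤ (q : ℝ) ^ 4 * (q : ℝ) ^ (d + 1 + 2 * r) := by
          gcongr
          exact le_trans (by norm_num) (pow_le_pow_left₀ (by norm_num) hqR 4)
      _ = (q : ℝ) ^ (8 * a + 43 * d + 35) := by rw [← pow_add, hr]; congr 1; ring
      _ ≤ (q : ℝ) ^ n := pow_le_pow_right₀ (by linarith) han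
  · refine pow_mul_exp_neg_le (by positivity) N ?_
    calc (N * q + 3 : ℝ) = δ / (12 * ((q : ℝ) ^ (d + 1)) ^ 3)
          * (12 * ((q : ℝ) ^ (d + 1)) ^ 3 / δ * (N * q + 3)) := by
          field_simp
      _ ≤ _ := by gcongr
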